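/- **Theorem (Kinnunen, 1997).** For $f\in L^1_{\mathrm{loc}}(\mathbb{R}^d)$ real-valued, let $$Mf(x)=\sup_{r>0}\frac{1}{m(B(x,r))}\int_{B(x,r)}|f(y)|\,dy\in[0,\infty]$$ be the centered Hardy–Littlewood maximal function, where $m$ is Lebesgue measure and $B(x,r)$ is the open Euclidean ball. Let $W^{1,p}(\mathbb{R}^d)$ be the space of real-valued $f\in L^p(\mathbb{R}^d)$ that have a weak gradient $\nabla f=(\partial_1 f,\dots,\partial_d f)\in L^p(\mathbb{R}^d)$, with norm $\|f\|_{W^{1,p}}=\|f\|_{L^p}+\|\nabla f\|_{L^p}$. Let $1<p<\infty$ and let $f\in W^{1,p}(\mathbb{R}^d)$. Then $Mf$ is finite almost everywhere and weakly differentiable, and for every $1\le i\le d$, $$|\partial_i Mf(x)|\le M(\partial_i f)(x)\qquad\text{for almost every }x\in\mathbb{R}^d.$$ Moreover, $M:W^{1,p}(\mathbb{R}^d)\to W^{1,p}(\mathbb{R}^d)$ is bounded: there is a finite constant $C=C(d,p)$ such that $Mf\in W^{1,p}(\mathbb{R}^d)$ and $\|Mf\|_{W^{1,p}}\le C\,\|f\|_{W^{1,p}}$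 for every $f\in W^{1,p}(\mathbb{R}^d)$. -/

import Mathlib

open MeasureTheory
open scoped ENNReal NNReal ContDiff

/-- The centered Hardy-Littlewood maximal function
`Mf(x) = sup_{r > 0} m(B(x,r))⁻¹ ∫_{B(x,r)} |f(y)| dy`, with values in `[0, ∞]`. -/
noncomputable def hlMaximal {d : ℕ} (f : EuclideanSpace ℝ (Fin d) → ℝ)
    (x : EuclideanSpace ℝ (Fin d)) : ℝ≥0∞ :=
  ⨆ (r : ℝ) (_ : 0 < r),
    (volume (Metric.ball x r))⁻¹ * ∫⁻ y in Metric.ball x r, ‖f y‖ₑ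

/-- The maximal function as a real-valued function; it is meaningful where `hlMaximal f x < ∞`. -/
noncomputable def hlMaximalReal {d : ℕ} (f : EuclideanSpace ℝ (Fin d) → ℝ)
    (x : EuclideanSpace ℝ (Fin d)) : ℝ :=
  (hlMaximal f x).toReal

/-- `v` is the `i`-th weak partial derivative of `u` on `ℝ^d`: both functions are locally
integrable and `∫ u ∂_i φ = - ∫ v φ` for every smooth compactly supported `φ`. -/
structure HasWeakPartialDeriv {d : ℕ} (i : Fin d) (u v : EuclideanSpace ℝ (Fin d) → ℝ) :
    Prop where
  locallyIntegrable : LocallyIntegrable u volume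
  locallyIntegrable_deriv : LocallyIntegrable v volume
  integral_eq : ∀ φ : EuclideanSpace ℝ (Fin d) → ℝ, ContDiff ℝ ∞ φ → HasCompactSupport φ →
    ∫ x, u x * fderiv ℝ φ x (EuclideanSpace.single i 1) = - ∫ x, v x * φ x

/-- `G` is the weak gradient of `u` on `ℝ^d`: its `i`-th component is the `i`-th weak partial
derivative of `u`. -/
structure HasWeakGradient {d : ℕ} (u : EuclideanSpace ℝ (Fin d) → ℝ)
    (G : EuclideanSpace ℝ (Fin d) → EuclideanSpace ℝ (Fin d)) : Prop where
  locallyIntegrable : LocallyIntegrable u volume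
  partialDeriv : ∀ i, HasWeakPartialDeriv i u (fun x => G x i)

/-- `u` is weakly differentiable on `ℝ^d`. -/
def WeaklyDifferentiable {d : ℕ} (u : EuclideanSpace ℝ (Fin d) → ℝ) : Prop :=
  ∃ G, HasWeakGradient u G

/-- Membership in the Sobolev space `W^{1,p}(ℝ^d)`: `u ∈ L^p` and `u` has a weak gradient
in `L^p`. -/
def MemW1p {d : ℕ} (p : ℝ≥0∞) (u : EuclideanSpace ℝ (Fin d) → ℝ) : Prop :=
  MemLp u p volume ∧ ∃ G, HasWeakGradient u G ∧ MemLp G p volume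

/-- The norm `‖u‖_{W^{1,p}} = ‖u‖_{L^p} + ‖∇u‖_{L^p}`. The weak gradient is unique up to null
sets, so the infimum runs over representatives of one class (see `w1pNorm_eq`); it is `∞` when `u`
has no weak gradient. -/
noncomputable def w1pNorm {d : ℕ} (p : ℝ≥0∞) (u : EuclideanSpace ℝ (Fin d) → ℝ) : ℝ≥0∞ :=
  eLpNorm u p volume +
    ⨅ (G : EuclideanSpace ℝ (Fin d) → EuclideanSpace ℝ (Fin d)) (_ : HasWeakGradient u G),
      eLpNorm G p volume

/-- Weak partial derivatives are unique up to null sets. -/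
theorem HasWeakPartialDeriv.ae_eq {d : ℕ} {i : Fin d} {u v w : EuclideanSpace ℝ (Fin d) → ℝ}
    (hv : HasWeakPartialDeriv i u v) (hw : HasWeakPartialDeriv i u w) : v =ᵐ[volume] w := by
  refine ae_eq_of_integral_contDiff_smul_eq hv.locallyIntegrable_deriv hw.locallyIntegrable_deriv
    fun φ hφ hc => ?_
  have h := (hv.integral_eq φ hφ hc).symm.trans (hw.integral_eq φ hφ hc)
  simpa [mul_comm] using h

/-- The Sobolev norm may be computed with any weak gradient. -/
theorem w1pNorm_eq {d : ℕ} (p : ℝ≥0∞) {u : EuclideanSpace ℝ (Fin d) → ℝ}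
    {G : EuclideanSpace ℝ (Fin d) → EuclideanSpace ℝ (Fin d)} (hG : HasWeakGradient u G) :
    w1pNorm p u = eLpNorm u p volume + eLpNorm G p volume := by
  unfold w1pNorm
  congr 1
  refine le_antisymm (iInf₂_le G hG) (le_iInf₂ fun H hH => le_of_eq (eLpNorm_congr_ae ?_))
  filter_upwards [ae_all_iff.2 fun i => (hG.partialDeriv i).ae_eq (hH.partialDeriv i)] with x hx
  ext i
  exact hx i

/-! ### The maximal function: measurability, weak type bound, strong type bound -/

section MaximalFunction

variable {d : ℕ}

/-! The core is a translation estimate. If `v` is the `i`-th weak derivative of `f` and `e` the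
`i`-th unit vector, then for each `h ≥ 0`, `|f (x + h e) - f x| ≤ ∫₀ʰ |v (x + t e)| dt` for almost
every `x`. Averaging over balls and using Tonelli turns this into `|Mf (x + h e) - Mf x| ≤ ∫₀ʰ Mv (x
+ t e) dt` wherever `Mf` is finite at both points (`HasWeakPartialDeriv.hlMaximal_translate_le`).

With `g = Mv`, dividing by `h` and letting `h → 0` against a test function gives `|∫ Mf ∂ₑφ| ≤ ∫ |φ|
g` (`enorm_integral_mul_fderiv_le`). So `φ ↦ ∫ Mf ∂ₑφ` is a functional dominated by the measure `g
dx`. A Riesz representation in a weighted `L²` space produces a density, and testing with mollifiers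
bounds it pointwise by `g` (`exists_integral_mul_fderiv_eq`). This gives the weak derivative of `Mf`
together with the bound by `Mv`; no weak compactness in `L^p` is used.

The Sobolev bound follows from the `L^p` bound for `M` (`exists_eLpNorm_hlMaximalReal_le`), applied
to `f` and to each component of its gradient. That bound comes from Vitali covering, truncation and
the layer cake formula. -/

theorem lt_hlMaximal_iff {f : EuclideanSpace ℝ (Fin d) → ℝ} {x : EuclideanSpace ℝ (Fin d)}
    {a : ℝ≥0∞} :
    a < hlMaximal f x ↔
      ∃ r : ℝ, 0 < r ∧ a < (volume (Metric.ball x r))⁻¹ * ∫⁻ y in Metric.ball x r, ‖f y‖ₑ := by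
  simp only [hlMaximal, lt_iSup_iff, exists_prop]

theorem average_le_hlMaximal (f : EuclideanSpace ℝ (Fin d) → ℝ) (x : EuclideanSpace ℝ (Fin d))
    {r : ℝ} (hr : 0 < r) :
    (volume (Metric.ball x r))⁻¹ * ∫⁻ y in Metric.ball x r, ‖f y‖ₑ ≤ hlMaximal f x :=
  le_iSup₂_of_le r hr le_rfl

theorem hlMaximal_congr_ae {f g : EuclideanSpace ℝ (Fin d) → ℝ} (h : f =ᵐ[volume] g) :
    hlMaximal f = hlMaximal g := by
  funext x
  refine iSup_congr fun r => iSup_congr fun _ => ?_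
  congr 1
  refine lintegral_congr_ae ?_
  filter_upwards [ae_restrict_of_ae h] with y hy
  rw [hy]

/-- A ball is the directed union of its concentric balls of smaller rational radius, so monotone
convergence recovers its integral, and the factor `volume⁻¹` only grows when the radius shrinks. A
countable supremum is what measurability needs. -/
theorem hlMaximal_eq_iSup_rat (f : EuclideanSpace ℝ (Fin d) → ℝ)
    (x : EuclideanSpace ℝ (Fin d)) :
    hlMaximal f x = ⨆ (q : ℚ) (_ : 0 < q),
      (volume (Metric.ball x (q : ℝ)))⁻¹ * ∫⁻ y in Metric.ball x (q : ℝ), ‖f y‖ₑ := by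
  apply le_antisymm
  · refine iSup₂_le fun r hr => ?_
    have hU : Metric.ball x r = ⋃ q : {q : ℚ // 0 < q ∧ (q : ℝ) < r}, Metric.ball x (q : ℝ) := by
      ext y
      simp only [Metric.mem_ball, Set.mem_iUnion, Subtype.exists, exists_prop]
      constructor
      · intro hy
        obtain ⟨q, hq1, hq2⟩ := exists_rat_btwn hy
        exact ⟨q, ⟨by exact_mod_cast dist_nonneg.trans_lt hq1, hq2⟩, hq1⟩
      · rintro ⟨q, ⟨_, hq⟩, hy⟩
        exact hy.trans hq
    have hdir : Directed (· ⊆ ·)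
        fun q : {q : ℚ // 0 < q ∧ (q : ℝ) < r} => Metric.ball x (q : ℝ) := by
      refine Monotone.directed_le (f := fun q : {q : ℚ // 0 < q ∧ (q : ℝ) < r} =>
        Metric.ball x (q : ℝ)) fun a b hab => Metric.ball_subset_ball ?_
      exact_mod_cast hab
    have hI : ∫⁻ y in Metric.ball x r, ‖f y‖ₑ
        = ⨆ q : {q : ℚ // 0 < q ∧ (q : ℝ) < r}, ∫⁻ y in Metric.ball x (q : ℝ), ‖f y‖ₑ := by
      rw [← setLIntegral_iUnion_of_directed _ hdir, ← hU]
    rw [hI, ENNReal.mul_iSup]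
    refine iSup_le fun q => ?_
    refine le_iSup₂_of_le q.1 q.2.1 ?_
    gcongr
    exact q.2.2.le
  · refine iSup₂_le fun q hq => average_le_hlMaximal f x (by exact_mod_cast hq)

theorem measurable_hlMaximal {f : EuclideanSpace ℝ (Fin d) → ℝ} (hf : AEMeasurable f volume) :
    Measurable (hlMaximal f) := by
  rw [hlMaximal_congr_ae hf.ae_eq_mk]
  have h : hlMaximal (hf.mk f) = fun x => ⨆ (q : ℚ) (_ : 0 < q),
      (volume (Metric.ball x (q : ℝ)))⁻¹ * ∫⁻ y in Metric.ball x (q : ℝ), ‖hf.mk f y‖ₑ :=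
    funext fun x => hlMaximal_eq_iSup_rat _ x
  rw [h]
  refine Measurable.iSup fun q => Measurable.iSup fun _ => ?_
  simp_rw [Measure.addHaar_ball_center]
  refine Measurable.const_mul ?_ _
  have hm : MeasurableSet {z : EuclideanSpace ℝ (Fin d) × EuclideanSpace ℝ (Fin d) |
      dist z.2 z.1 < q} := measurableSet_lt (measurable_snd.dist measurable_fst) measurable_const
  have := ((hf.measurable_mk.enorm.comp measurable_snd).indicator hm).lintegral_prod_right'
    (ν := (volume : Measure (EuclideanSpace ℝ (Fin d))))
  convert this using 2 with x
  rw [← lintegral_indicator Metric.isOpen_ball.measurableSet]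
  rfl

/-- Weak type (1,1) by Vitali covering: disjoint balls with average above `a`, enlarged five times,
cover the superlevel set, whence the factor `5 ^ d`. -/
theorem mul_volume_lt_hlMaximal_le (f : EuclideanSpace ℝ (Fin d) → ℝ) (a : ℝ≥0∞) :
    a * volume {x | a < hlMaximal f x} ≤ 5 ^ d * ∫⁻ y, ‖f y‖ₑ := by
  -- Vitali's lemma needs bounded radii, so they are capped at `n`; the sets increase to the
  -- superlevel set.
  set S : ℕ → Set (EuclideanSpace ℝ (Fin d)) := fun n => {x | ∃ r : ℝ, 0 < r ∧ r ≤ n ∧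
    a < (volume (Metric.ball x r))⁻¹ * ∫⁻ y in Metric.ball x r, ‖f y‖ₑ} with hS
  have hmono : Monotone S := fun m n hmn x ⟨r, h0, h1, h2⟩ =>
    ⟨r, h0, h1.trans (by exact_mod_cast hmn), h2⟩
  have hU : {x | a < hlMaximal f x} = ⋃ n, S n := by
    ext x
    simp only [Set.mem_ofPred_eq, Set.mem_iUnion, lt_hlMaximal_iff, hS]
    constructor
    · rintro ⟨r, h0, h1⟩
      obtain ⟨n, hn⟩ := exists_nat_ge r
      exact ⟨n, r, h0, hn, h1⟩
    · rintro ⟨n, r, h0, -, h1⟩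
      exact ⟨r, h0, h1⟩
  rw [hU, hmono.measure_iUnion, ENNReal.mul_iSup]
  refine iSup_le fun n => ?_
  have hex : ∀ x : EuclideanSpace ℝ (Fin d), ∃ r : ℝ, x ∈ S n → (0 < r ∧ r ≤ n ∧
    a < (volume (Metric.ball x r))⁻¹ * ∫⁻ y in Metric.ball x r, ‖f y‖ₑ) := by
    intro x
    by_cases hx : x ∈ S n
    · obtain ⟨r, hr⟩ := hx
      exact ⟨r, fun _ => hr⟩
    · exact ⟨0, fun h => absurd h hx⟩
  choose r hr using hex
  obtain ⟨u, hut, hdisj, hcov⟩ := Vitali.exists_disjoint_subfamily_covering_enlargement_closedBall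
    (S n) (fun x => x) r n (fun x hx => (hr x hx).2.1) 5 (by norm_num)
  have hcount : u.Countable := hdisj.countable_of_nonempty_interior fun x hx => by
    refine ⟨x, interior_mono Metric.ball_subset_closedBall ?_⟩
    rw [Metric.isOpen_ball.interior_eq]
    exact Metric.mem_ball_self (hr x (hut hx)).1
  have hsub : S n ⊆ ⋃ x ∈ u, Metric.closedBall x (5 * r x) := by
    intro x hx
    obtain ⟨b, hb, hxb⟩ := hcov x hx
    exact Set.mem_biUnion hb (hxb (Metric.mem_closedBall_self (hr x hx).1.le))
  have hball : ∀ x ∈ u, a * volume (Metric.closedBall x (5 * r x))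
      ≤ 5 ^ d * ∫⁻ y in Metric.ball x (r x), ‖f y‖ₑ := by
    intro x hx
    obtain ⟨h0, -, h1⟩ := hr x (hut hx)
    have hv : volume (Metric.closedBall x (r x)) = volume (Metric.ball x (r x)) := by
      rw [← Metric.ball_union_sphere]
      refine le_antisymm ((measure_union_le _ _).trans ?_) (measure_mono Set.subset_union_left)
      rw [Measure.addHaar_sphere_of_ne_zero _ _ h0.ne', add_zero]
    have h5 : volume (Metric.closedBall x (5 * r x)) = 5 ^ d * volume (Metric.ball x (r x)) := by
      rw [Measure.addHaar_closedBall_mul _ _ (by norm_num) h0.le, ← hv,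
        Measure.addHaar_closedBall_center volume x]
      congr 1
      rw [finrank_euclideanSpace_fin, ENNReal.ofReal_pow (by norm_num)]
      norm_num
    have hpos : volume (Metric.ball x (r x)) ≠ 0 := (Metric.measure_ball_pos _ _ h0).ne'
    have hfin : volume (Metric.ball x (r x)) ≠ ⊤ := measure_ball_lt_top.ne
    rw [h5, mul_left_comm]
    gcongr
    rw [mul_comm, ← div_eq_mul_inv] at h1
    exact (ENNReal.le_div_iff_mul_le (Or.inl hpos) (Or.inl hfin)).1 h1.le
  calc a * volume (S n) ≤ a * volume (⋃ x ∈ u, Metric.closedBall x (5 * r x)) := by gcongr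
    _ ≤ a * ∑' x : u, volume (Metric.closedBall (x : EuclideanSpace ℝ (Fin d)) (5 * r x)) := by
        gcongr
        exact measure_biUnion_le _ hcount _
    _ = ∑' x : u, a * volume (Metric.closedBall (x : EuclideanSpace ℝ (Fin d)) (5 * r x)) := by
        rw [ENNReal.tsum_mul_left]
    _ ≤ ∑' x : u, 5 ^ d * ∫⁻ y in Metric.ball (x : EuclideanSpace ℝ (Fin d)) (r x), ‖f y‖ₑ :=
        ENNReal.tsum_le_tsum fun x => hball x x.2
    _ = 5 ^ d * ∫⁻ y in ⋃ x ∈ u, Metric.ball x (r x), ‖f y‖ₑ := by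
        rw [ENNReal.tsum_mul_left, lintegral_biUnion hcount
          (fun _ _ => Metric.isOpen_ball.measurableSet)
          (hdisj.mono fun _ => Metric.ball_subset_closedBall)]
    _ ≤ 5 ^ d * ∫⁻ y, ‖f y‖ₑ := by
        gcongr 5 ^ d * ?_
        exact setLIntegral_le_lintegral _ _

theorem hlMaximal_le_add (f g : EuclideanSpace ℝ (Fin d) → ℝ) {a : ℝ≥0∞}
    (h : ∀ y, ‖f y‖ₑ ≤ ‖g y‖ₑ + a) (x : EuclideanSpace ℝ (Fin d)) :
    hlMaximal f x ≤ hlMaximal g x + a := by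
  refine iSup₂_le fun r hr => ?_
  have hpos : volume (Metric.ball x r) ≠ 0 := (Metric.measure_ball_pos _ _ hr).ne'
  have hfin : volume (Metric.ball x r) ≠ ⊤ := measure_ball_lt_top.ne
  calc (volume (Metric.ball x r))⁻¹ * ∫⁻ y in Metric.ball x r, ‖f y‖ₑ
      ≤ (volume (Metric.ball x r))⁻¹ * ∫⁻ y in Metric.ball x r, (‖g y‖ₑ + a) := by
        gcongr with y
        exact h y
    _ = (volume (Metric.ball x r))⁻¹ * (∫⁻ y in Metric.ball x r, ‖g y‖ₑ) + a := by
        rw [lintegral_add_right _ measurable_const, setLIntegral_const, mul_add, mul_left_comm,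
          ENNReal.inv_mul_cancel hpos hfin, mul_one]
    _ ≤ hlMaximal g x + a := by
        gcongr
        exact average_le_hlMaximal g x hr

/-- The part of `f` of size at most `a` raises the maximal function by at most `a`, so above level
`2 * a` the truncation to `a < |f|` must itself have maximal function above `a`. -/
theorem mul_volume_two_mul_lt_hlMaximal_le {f : EuclideanSpace ℝ (Fin d) → ℝ}
    (hf : Measurable f) {a : ℝ≥0∞} (ha : a ≠ ⊤) :
    a * volume {x | 2 * a < hlMaximal f x} ≤ 5 ^ d * ∫⁻ y in {y | a < ‖f y‖ₑ}, ‖f y‖ₑ := by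
  have hm : MeasurableSet {y | a < ‖f y‖ₑ} := measurableSet_lt measurable_const hf.enorm
  set g := {y | a < ‖f y‖ₑ}.indicator f with hg
  have hgf : ∫⁻ y, ‖g y‖ₑ = ∫⁻ y in {y | a < ‖f y‖ₑ}, ‖f y‖ₑ := by
    rw [← lintegral_indicator hm]
    simp only [hg, enorm_indicator_eq_indicator_enorm]
  rw [← hgf]
  refine le_trans ?_ (mul_volume_lt_hlMaximal_le g a)
  gcongr a * ?_
  refine measure_mono fun x hx => ?_
  have h1 : hlMaximal f x ≤ hlMaximal g x + a := by
    refine hlMaximal_le_add f g (fun y => ?_) x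
    by_cases hy : a < ‖f y‖ₑ
    · have : g y = f y := Set.indicator_of_mem (s := {y | a < ‖f y‖ₑ}) hy f
      rw [this]
      exact le_self_add
    · exact (not_lt.1 hy).trans le_add_self
  have h2 : a + a < hlMaximal g x + a := by
    rw [← two_mul]
    exact lt_of_lt_of_le hx h1
  exact (ENNReal.add_lt_add_iff_right ha).1 h2

/-- This must be shown separately from the `L^p` bound, because `hlMaximalReal` sends the value `∞`
to `0`. -/
theorem ae_hlMaximal_lt_top {f : EuclideanSpace ℝ (Fin d) → ℝ} {p : ℝ≥0∞} (hp : 1 ≤ p)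
    (hp_top : p ≠ ⊤) (hf : MemLp f p volume) : ∀ᵐ x, hlMaximal f x < ⊤ := by
  wlog hfm : Measurable f generalizing f
  · have := this (hf.ae_eq hf.aestronglyMeasurable.aemeasurable.ae_eq_mk)
      hf.aestronglyMeasurable.aemeasurable.measurable_mk
    rwa [hlMaximal_congr_ae hf.aestronglyMeasurable.aemeasurable.ae_eq_mk]
  have hp1 : 1 ≤ p.toReal := by
    rw [← ENNReal.toReal_one]
    exact ENNReal.toReal_mono hp_top hp
  set A : ℝ≥0∞ := 5 ^ d * ∫⁻ y, ‖f y‖ₑ ^ p.toReal with hA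
  have hAfin : A ≠ ⊤ := by
    refine ENNReal.mul_ne_top (by finiteness) ?_
    exact (lintegral_rpow_enorm_lt_top_of_eLpNorm_lt_top (by positivity) hp_top
      hf.eLpNorm_lt_top).ne
  -- Levels start at `1`, so that `|f| ≤ |f| ^ p` on the truncation set and the bound `A` is
  -- independent of `n`.
  have hbound : ∀ n : ℕ, (n + 1 : ℝ≥0∞) * volume {x | hlMaximal f x = ⊤} ≤ A := by
    intro n
    calc (n + 1 : ℝ≥0∞) * volume {x | hlMaximal f x = ⊤}
        ≤ (n + 1 : ℝ≥0∞) * volume {x | 2 * (n + 1 : ℝ≥0∞) < hlMaximal f x} := by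
          gcongr (n + 1 : ℝ≥0∞) * ?_
          refine measure_mono fun x hx => ?_
          have hx : hlMaximal f x = ⊤ := hx
          rw [Set.mem_ofPred_eq, hx]
          finiteness
      _ ≤ 5 ^ d * ∫⁻ y in {y | (n + 1 : ℝ≥0∞) < ‖f y‖ₑ}, ‖f y‖ₑ :=
          mul_volume_two_mul_lt_hlMaximal_le hfm (by finiteness)
      _ ≤ 5 ^ d * ∫⁻ y in {y | (n + 1 : ℝ≥0∞) < ‖f y‖ₑ}, ‖f y‖ₑ ^ p.toReal := by
          refine mul_le_mul_right ?_ _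
          refine setLIntegral_mono' (measurableSet_lt measurable_const hfm.enorm) fun y hy => ?_
          have h1 : 1 ≤ ‖f y‖ₑ := le_trans le_add_self (le_of_lt hy)
          exact ENNReal.le_rpow_self_of_one_le h1 hp1
      _ ≤ A := by
          rw [hA]
          gcongr 5 ^ d * ?_
          exact setLIntegral_le_lintegral _ _
  have hzero : volume {x | hlMaximal f x = ⊤} = 0 := by
    by_contra hne
    have : ∀ n : ℕ, (n : ℝ≥0∞) ≤ A / volume {x | hlMaximal f x = ⊤} := fun n =>
      (ENNReal.le_div_iff_mul_le (Or.inl hne) (Or.inr hAfin)).2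
        (le_trans (by gcongr; exact le_self_add) (hbound n))
    obtain ⟨n, hn⟩ := ENNReal.exists_nat_gt (ENNReal.div_ne_top hAfin hne)
    exact absurd (this n) (not_le.2 hn)
  rw [ae_iff]
  simpa using hzero

theorem enorm_hlMaximalReal_ae_eq {f : EuclideanSpace ℝ (Fin d) → ℝ} {p : ℝ≥0∞} (hp : 1 ≤ p)
    (hp_top : p ≠ ⊤) (hf : MemLp f p volume) :
    (fun x => ‖hlMaximalReal f x‖ₑ) =ᵐ[volume] hlMaximal f := by
  filter_upwards [ae_hlMaximal_lt_top hp hp_top hf] with x hx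
  rw [hlMaximalReal, Real.enorm_of_nonneg ENNReal.toReal_nonneg, ENNReal.ofReal_toReal hx.ne]

/-- Marcinkiewicz interpolation by hand: the layer cake formula for `Mf` with exponent `q`, the
truncated weak bound at height `t / 2`, then the layer cake formula backwards for `2 * |f|` with
exponent `q - 1` and measure `|f| dx`. -/
theorem lintegral_hlMaximalReal_rpow_le {f : EuclideanSpace ℝ (Fin d) → ℝ} (hf : Measurable f)
    {q : ℝ} (hq : 1 < q) :
    ∫⁻ x, ‖hlMaximalReal f x‖ₑ ^ q ≤
      ENNReal.ofReal q * (2 * 5 ^ d * (ENNReal.ofReal (q - 1))⁻¹ * 2 ^ (q - 1)) *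
        ∫⁻ x, ‖f x‖ₑ ^ q := by
  have hM : Measurable (hlMaximalReal f) := (measurable_hlMaximal hf.aemeasurable).ennreal_toReal
  have hM0 : ∀ x, 0 ≤ hlMaximalReal f x := fun x => ENNReal.toReal_nonneg
  set ν : Measure (EuclideanSpace ℝ (Fin d)) := volume.withDensity fun y => ‖f y‖ₑ with hν
  have hcake := lintegral_rpow_eq_lintegral_meas_lt_mul volume
    (Filter.Eventually.of_forall hM0) hM.aemeasurable (show 0 < q by linarith)
  have hcake2 := lintegral_rpow_eq_lintegral_meas_lt_mul ν
    (f := fun y => 2 * |f y|) (Filter.Eventually.of_forall fun y => by positivity)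
    (by fun_prop) (show 0 < q - 1 by linarith)
  have hL : ∫⁻ x, ‖hlMaximalReal f x‖ₑ ^ q = ∫⁻ x, ENNReal.ofReal (hlMaximalReal f x ^ q) := by
    refine lintegral_congr fun x => ?_
    rw [Real.enorm_of_nonneg (hM0 x), ENNReal.ofReal_rpow_of_nonneg (hM0 x) (by linarith)]
  have hR : ∫⁻ y, ENNReal.ofReal ((2 * |f y|) ^ (q - 1)) ∂ν
      = 2 ^ (q - 1) * ∫⁻ y, ‖f y‖ₑ ^ q := by
    rw [hν, lintegral_withDensity_eq_lintegral_mul _ hf.enorm (by fun_prop),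
      ← lintegral_const_mul _ (by fun_prop)]
    refine lintegral_congr fun y => ?_
    rw [Pi.mul_apply, ← ENNReal.ofReal_rpow_of_nonneg (by positivity) (by linarith),
      ENNReal.ofReal_mul (by norm_num), ENNReal.mul_rpow_of_nonneg _ _ (by linarith),
      ← Real.enorm_eq_ofReal_abs, mul_left_comm]
    congr 1
    · norm_num
    · nth_rewrite 1 [← ENNReal.rpow_one ‖f y‖ₑ]
      rw [← ENNReal.rpow_add_of_nonneg _ _ (by norm_num) (by linarith)]
      congr 1
      ring
  have hdist : ∀ t ∈ Set.Ioi (0 : ℝ),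
      volume {x | t < hlMaximalReal f x} * ENNReal.ofReal (t ^ (q - 1))
        ≤ (2 * 5 ^ d) * (ν {y | t < 2 * |f y|} * ENNReal.ofReal (t ^ (q - 1 - 1))) := by
    intro t ht
    have ht : 0 < t := ht
    set a := ENNReal.ofReal (t / 2) with ha
    have hsub : {x | t < hlMaximalReal f x} ⊆ {x | 2 * a < hlMaximal f x} := by
      intro x hx
      have hx : t < (hlMaximal f x).toReal := hx
      have h2a : 2 * a = ENNReal.ofReal t := by
        rw [ha, ← ENNReal.ofReal_ofNat, ← ENNReal.ofReal_mul (by norm_num)]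
        congr 1
        ring
      rw [Set.mem_ofPred_eq, h2a]
      exact (ENNReal.ofReal_lt_iff_lt_toReal ht.le
        (fun h => by simp [h] at hx; linarith)).2 hx
    have hset : {y | a < ‖f y‖ₑ} = {y | t < 2 * |f y|} := by
      ext y
      rw [Set.mem_ofPred_eq, Set.mem_ofPred_eq, Real.enorm_eq_ofReal_abs, ha,
        ENNReal.ofReal_lt_ofReal_iff_of_nonneg (by positivity)]
      constructor <;> intro h <;> linarith
    have hνs : ν {y | t < 2 * |f y|} = ∫⁻ y in {y | a < ‖f y‖ₑ}, ‖f y‖ₑ := by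
      rw [hν, hset, withDensity_apply _
        (measurableSet_lt measurable_const (by fun_prop))]
    have hw := mul_volume_two_mul_lt_hlMaximal_le hf (a := a) ENNReal.ofReal_ne_top
    rw [← hνs] at hw
    have hpow : ENNReal.ofReal (t ^ (q - 1)) = 2 * a * ENNReal.ofReal (t ^ (q - 1 - 1)) := by
      rw [ha, ← ENNReal.ofReal_ofNat, ← ENNReal.ofReal_mul (by norm_num),
        ← ENNReal.ofReal_mul (by positivity), Real.rpow_sub_one ht.ne' (q - 1)]
      congr 1
      field_simp
    calc volume {x | t < hlMaximalReal f x} * ENNReal.ofReal (t ^ (q - 1))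
        ≤ volume {x | 2 * a < hlMaximal f x} * ENNReal.ofReal (t ^ (q - 1)) := by gcongr
      _ = 2 * ENNReal.ofReal (t ^ (q - 1 - 1)) * (a * volume {x | 2 * a < hlMaximal f x}) := by
          rw [hpow]
          ring
      _ ≤ 2 * ENNReal.ofReal (t ^ (q - 1 - 1)) * (5 ^ d * ν {y | t < 2 * |f y|}) := by gcongr
      _ = _ := by ring
  have hq0 : ENNReal.ofReal (q - 1) ≠ 0 := by simpa using hq
  calc ∫⁻ x, ‖hlMaximalReal f x‖ₑ ^ q
      = ENNReal.ofReal q * ∫⁻ t in Set.Ioi (0 : ℝ),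
          volume {x | t < hlMaximalReal f x} * ENNReal.ofReal (t ^ (q - 1)) := by rw [hL, hcake]
    _ ≤ ENNReal.ofReal q * ∫⁻ t in Set.Ioi (0 : ℝ),
          (2 * 5 ^ d) * (ν {y | t < 2 * |f y|} * ENNReal.ofReal (t ^ (q - 1 - 1))) := by
        gcongr 1
        exact setLIntegral_mono' measurableSet_Ioi hdist
    _ = ENNReal.ofReal q * ((2 * 5 ^ d) * ((ENNReal.ofReal (q - 1))⁻¹ *
          (ENNReal.ofReal (q - 1) * ∫⁻ t in Set.Ioi (0 : ℝ),
            ν {y | t < 2 * |f y|} * ENNReal.ofReal (t ^ (q - 1 - 1))))) := by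
        rw [lintegral_const_mul' _ _ (by finiteness), ← mul_assoc (ENNReal.ofReal (q - 1))⁻¹,
          ENNReal.inv_mul_cancel hq0 ENNReal.ofReal_ne_top, one_mul]
    _ = _ := by
        rw [← hcake2, hR]
        ring

theorem exists_eLpNorm_hlMaximalReal_le (d : ℕ) {p : ℝ≥0∞} (hp : 1 < p) (hp_top : p < ⊤) :
    ∃ C : ℝ≥0, ∀ f : EuclideanSpace ℝ (Fin d) → ℝ, MemLp f p volume →
      MemLp (hlMaximalReal f) p volume ∧
        eLpNorm (hlMaximalReal f) p volume ≤ C * eLpNorm f p volume := by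
  have hq : 1 < p.toReal := by
    rw [← ENNReal.toReal_one]
    exact (ENNReal.toReal_lt_toReal (by simp) hp_top.ne).2 hp
  have hq0 : ENNReal.ofReal (p.toReal - 1) ≠ 0 := by simpa using hq
  set K : ℝ≥0∞ := ENNReal.ofReal p.toReal *
    (2 * 5 ^ d * (ENNReal.ofReal (p.toReal - 1))⁻¹ * 2 ^ (p.toReal - 1)) with hK
  have hKfin : K ^ (1 / p.toReal) ≠ ⊤ := by
    have h1 : (ENNReal.ofReal (p.toReal - 1))⁻¹ ≠ ⊤ := ENNReal.inv_ne_top.2 hq0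
    have h2 : (2 : ℝ≥0∞) ^ (p.toReal - 1) ≠ ⊤ :=
      ENNReal.rpow_ne_top_of_nonneg (by linarith) (by simp)
    exact ENNReal.rpow_ne_top_of_nonneg (by positivity) (by finiteness)
  have hp0 : p ≠ 0 := (zero_lt_one.trans hp).ne'
  refine ⟨(K ^ (1 / p.toReal)).toNNReal, fun f hf => ?_⟩
  have hle : eLpNorm (hlMaximalReal f) p volume
      ≤ (K ^ (1 / p.toReal)).toNNReal * eLpNorm f p volume := by
    wlog hfm : Measurable f generalizing f
    · have hae := hf.aestronglyMeasurable.aemeasurable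
      have := this (hae.mk f) (hf.ae_eq hae.ae_eq_mk) hae.measurable_mk
      rw [eLpNorm_congr_ae hae.ae_eq_mk]
      have hcongr : hlMaximalReal f = hlMaximalReal (hae.mk f) := by
        funext x
        rw [hlMaximalReal, hlMaximalReal, hlMaximal_congr_ae hae.ae_eq_mk]
      rwa [hcongr]
    rw [ENNReal.coe_toNNReal hKfin, eLpNorm_eq_lintegral_rpow_enorm_toReal hp0 hp_top.ne,
      eLpNorm_eq_lintegral_rpow_enorm_toReal hp0 hp_top.ne,
      ← ENNReal.mul_rpow_of_nonneg _ _ (by positivity)]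
    gcongr
    exact lintegral_hlMaximalReal_rpow_le hfm hq
  refine ⟨⟨(measurable_hlMaximal
    hf.aestronglyMeasurable.aemeasurable).ennreal_toReal.aestronglyMeasurable, ?_⟩, hle⟩
  exact hle.trans_lt (ENNReal.mul_lt_top ENNReal.coe_lt_top hf.eLpNorm_lt_top)

end MaximalFunction

/-! ### Integrability of products of translates -/

section TranslatedProducts

variable {E : Type*} [NormedAddCommGroup E] [NormedSpace ℝ E] [FiniteDimensional ℝ E]
  [MeasurableSpace E] [BorelSpace E] {μ : Measure E} [μ.IsAddHaarMeasure]

theorem MeasureTheory.LocallyIntegrable.comp_add_right {v : E → ℝ}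
    (hv : LocallyIntegrable v μ) (a : E) :
    LocallyIntegrable (fun x => v (x + a)) μ := by
  rw [locallyIntegrable_iff] at hv ⊢
  intro K hK
  have h := hv _ (hK.image (continuous_add_const a))
  rw [← (measurePreserving_add_right μ a).integrableOn_comp_preimage
    (MeasurableEquiv.addRight a).measurableEmbedding] at h
  exact h.mono_set (Set.subset_preimage_image _ _)

theorem integral_mul_translate_sub {f φ : E → ℝ} (hf : LocallyIntegrable f μ) (hφ : Continuous φ)
    (hc : HasCompactSupport φ) (a : E) :
    ∫ x, φ x * (f (x + a) - f x) ∂μ = ∫ x, f x * (φ (x + -a) - φ x) ∂μ := by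
  have hcφ : HasCompactSupport fun x => φ (x + -a) := hc.comp_homeomorph (Homeomorph.addRight (-a))
  have i1 : Integrable (fun x => φ x * f x) μ :=
    hf.integrable_smul_left_of_hasCompactSupport hφ hc
  have i2 : Integrable (fun x => φ x * f (x + a)) μ :=
    (LocallyIntegrable.comp_add_right hf _).integrable_smul_left_of_hasCompactSupport hφ hc
  have i3 : Integrable (fun x => φ (x + -a) * f x) μ :=
    hf.integrable_smul_left_of_hasCompactSupport (hφ.comp (continuous_add_const _)) hcφ
  have i4 : ∫ x, φ x * f (x + a) ∂μ = ∫ x, φ (x + -a) * f x ∂μ := by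
    rw [← integral_add_right_eq_self (fun x => φ (x + -a) * f x) a]
    simp
  simp only [mul_sub]
  rw [integral_sub i2 i1, i4, ← integral_sub i3 i1]
  simp only [mul_comm]

/-- Justifies Fubini in the shift parameter. Where `ψ (x + b t)` is nonzero, `x + a t` lies in the
ball of radius `R + S`, so every slice is bounded by `C` times one fixed integral of `|v|`. Two
shifts are allowed because either factor may be the translated one. -/
theorem integrable_translate_mul_translate {v ψ : E → ℝ} (hvm : Measurable v)
    (hv : LocallyIntegrable v μ) (hψm : Measurable ψ) {C : ℝ≥0} (hψC : ∀ x, ‖ψ x‖ₑ ≤ C) {R : ℝ}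
    (hψR : ∀ x, R < ‖x‖ → ψ x = 0) {a b : ℝ → E} (ha : Measurable a) (hb : Measurable b) {h S : ℝ}
    (hab : ∀ t ∈ Set.Ioc 0 h, ‖a t - b t‖ ≤ S) :
    Integrable (fun z : E × ℝ => v (z.1 + a z.2) * ψ (z.1 + b z.2))
      (μ.prod (volume.restrict (Set.Ioc 0 h))) := by
  have hm : Measurable (fun z : E × ℝ => v (z.1 + a z.2) * ψ (z.1 + b z.2)) :=
    (hvm.comp (measurable_fst.add (ha.comp measurable_snd))).mul
      (hψm.comp (measurable_fst.add (hb.comp measurable_snd)))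
  refine ⟨hm.aestronglyMeasurable, ?_⟩
  set K : Set E := Metric.closedBall 0 (R + S) with hK
  have hKfin : ∫⁻ x in K, ‖v x‖ₑ ∂μ < ⊤ :=
    (hv.integrableOn_isCompact (isCompact_closedBall _ _)).hasFiniteIntegral
  have hslice : ∀ t ∈ Set.Ioc 0 h, ∫⁻ x, ‖v (x + a t) * ψ (x + b t)‖ₑ ∂μ
      ≤ C * ∫⁻ x in K, ‖v x‖ₑ ∂μ := by
    intro t ht
    calc ∫⁻ x, ‖v (x + a t) * ψ (x + b t)‖ₑ ∂μ
        ≤ ∫⁻ x, C * K.indicator (fun y => ‖v y‖ₑ) (x + a t) ∂μ := by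
          refine lintegral_mono fun x => ?_
          rw [enorm_mul, mul_comm]
          by_cases hx : x + a t ∈ K
          · rw [Set.indicator_of_mem hx]
            gcongr
            exact hψC _
          · have hlt : R < ‖x + b t‖ := by
              by_contra! hle
              refine hx ?_
              rw [hK, mem_closedBall_zero_iff]
              calc ‖x + a t‖ = ‖(x + b t) + (a t - b t)‖ := by congr 1; abel
                _ ≤ R + S := (norm_add_le _ _).trans (add_le_add hle (hab t ht))
            simp [hψR _ hlt]
      _ = C * ∫⁻ x, K.indicator (fun y => ‖v y‖ₑ) x ∂μ := by
          rw [lintegral_const_mul' _ _ ENNReal.coe_ne_top,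
            lintegral_add_right_eq_self (fun x => K.indicator (fun y => ‖v y‖ₑ) x)]
      _ = C * ∫⁻ x in K, ‖v x‖ₑ ∂μ := by
          rw [lintegral_indicator Metric.isClosed_closedBall.measurableSet]
  rw [HasFiniteIntegral, lintegral_prod_symm' _ hm.enorm]
  calc ∫⁻ t in Set.Ioc 0 h, ∫⁻ x, ‖v (x + a t) * ψ (x + b t)‖ₑ ∂μ
      ≤ ∫⁻ _ in Set.Ioc 0 h, C * ∫⁻ x in K, ‖v x‖ₑ ∂μ :=
        setLIntegral_mono' measurableSet_Ioc hslice
    _ < ⊤ := by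
        rw [setLIntegral_const]
        have : volume (Set.Ioc 0 h) < ⊤ := measure_Ioc_lt_top
        finiteness

theorem MeasureTheory.LocallyIntegrable.setIntegral_translate {v : E → ℝ} (hvm : Measurable v)
    (hv : LocallyIntegrable v μ) (e : E) (h : ℝ) :
    LocallyIntegrable (fun x => ∫ t in Set.Ioc 0 h, v (x + t • e)) μ := by
  rw [locallyIntegrable_iff]
  intro K hK
  obtain ⟨R, hR⟩ := hK.isBounded.subset_closedBall 0
  have hint := integrable_translate_mul_translate (ψ := (Metric.closedBall (0 : E) R).indicator 1)
    (a := fun t => t • e) (b := fun _ => 0) (C := 1) (R := R) (S := h * ‖e‖) (h := h) hvm hv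
    (measurable_one.indicator Metric.isClosed_closedBall.measurableSet)
    (fun x => by
      by_cases hx : x ∈ Metric.closedBall (0 : E) R <;> simp [hx])
    (fun x hx => Set.indicator_of_notMem (by simpa using hx) _)
    (by fun_prop) measurable_const
    (fun t ht => by
      rw [sub_zero, norm_smul, Real.norm_of_nonneg ht.1.le]
      exact mul_le_mul_of_nonneg_right ht.2 (norm_nonneg _))
  refine IntegrableOn.mono_set ?_ hR
  refine (integrable_indicator_iff Metric.isClosed_closedBall.measurableSet).1 ?_
  refine hint.integral_prod_left.congr (Filter.Eventually.of_forall fun x => ?_)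
  by_cases hx : x ∈ Metric.closedBall (0 : E) R <;> simp [Set.indicator, hx]

end TranslatedProducts

/-! ### Translation estimates for weakly differentiable functions -/

section WeakDerivative

variable {d : ℕ}

theorem HasWeakPartialDeriv.congr_ae {i : Fin d} {u u' v v' : EuclideanSpace ℝ (Fin d) → ℝ}
    (h : HasWeakPartialDeriv i u v) (hu : u =ᵐ[volume] u') (hv : v =ᵐ[volume] v') :
    HasWeakPartialDeriv i u' v' where
  locallyIntegrable := h.locallyIntegrable.congr hu
  locallyIntegrable_deriv := h.locallyIntegrable_deriv.congr hv
  integral_eq φ hφ hc := by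
    refine Eq.trans (integral_congr_ae ?_)
      ((h.integral_eq φ hφ hc).trans (congrArg Neg.neg (integral_congr_ae ?_)))
    · filter_upwards [hu] with x hx
      rw [hx]
    · filter_upwards [hv] with x hx
      rw [hx]

theorem exists_bound_of_hasCompactSupport {E : Type*} [NormedAddCommGroup E] {ψ : E → ℝ}
    (hψ : Continuous ψ) (hc : HasCompactSupport ψ) :
    ∃ (C : ℝ≥0) (R : ℝ), (∀ x, ‖ψ x‖ₑ ≤ C) ∧ ∀ x, R < ‖x‖ → ψ x = 0 := by
  obtain ⟨C, hC⟩ := hψ.bounded_above_of_compact_support hc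
  obtain ⟨R, hR⟩ := hc.isCompact.isBounded.subset_closedBall 0
  refine ⟨C.toNNReal, R, fun x => ?_, fun x hx => ?_⟩
  · rw [← ofReal_norm]
    exact ENNReal.ofReal_le_ofReal (hC x)
  · by_contra hne
    have := hR (subset_tsupport ψ hne)
    rw [mem_closedBall_zero_iff] at this
    linarith

theorem setIntegral_fderiv_translate {E : Type*} [NormedAddCommGroup E] [NormedSpace ℝ E]
    {φ : E → ℝ} (hφ : ContDiff ℝ ∞ φ) (x e : E) {h : ℝ} (hh : 0 ≤ h) :
    ∫ t in Set.Ioc 0 h, fderiv ℝ φ (x + -(t • e)) e = φ x - φ (x + -(h • e)) := by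
  have hd : ∀ t ∈ Set.uIcc 0 h,
      HasDerivAt (fun t : ℝ => -φ (x + -(t • e))) (fderiv ℝ φ (x + -(t • e)) e) t := by
    intro t _
    have h1 : HasDerivAt (fun t : ℝ => x + -(t • e)) (-e) t := by
      simpa using (((hasDerivAt_id t).smul_const e).neg).const_add x
    have h2 := ((hφ.differentiable (by simp)) (x + -(t • e))).hasFDerivAt.comp_hasDerivAt t h1
    simpa using! h2.neg
  have hcont : Continuous fun t : ℝ => fderiv ℝ φ (x + -(t • e)) e := by
    have := hφ.continuous_fderiv (by simp)
    fun_prop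
  rw [← intervalIntegral.integral_of_le hh, intervalIntegral.integral_eq_sub_of_hasDerivAt hd
    (hcont.intervalIntegrable _ _)]
  simp [sub_eq_add_neg, add_comm]

/-- The fundamental theorem of calculus in weak form. Against a test function the increment moves
onto `φ`, where it is the integral of a classical derivative; Fubini and the definition of the weak
derivative at each `t` bring it back to `v`. The exceptional set may depend on `h`. -/
theorem HasWeakPartialDeriv.ae_sub_eq_setIntegral {i : Fin d}
    {f v : EuclideanSpace ℝ (Fin d) → ℝ} (hfv : HasWeakPartialDeriv i f v) (hf : Measurable f)
    (hv : Measurable v) {h : ℝ} (hh : 0 ≤ h) :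
    ∀ᵐ x, f (x + h • EuclideanSpace.single i 1) - f x
      = ∫ t in Set.Ioc 0 h, v (x + t • EuclideanSpace.single i 1) := by
  set e : EuclideanSpace ℝ (Fin d) := EuclideanSpace.single i 1 with he
  have hfi := hfv.locallyIntegrable
  have hvi := hfv.locallyIntegrable_deriv
  refine ae_eq_of_integral_contDiff_smul_eq ((LocallyIntegrable.comp_add_right hfi _).sub hfi)
    (LocallyIntegrable.setIntegral_translate hv hvi e h) fun φ hφ hc => ?_
  have hnorm : ∀ t ∈ Set.Ioc 0 h, ‖t • e‖ ≤ h * ‖e‖ := fun t ht => by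
    rw [norm_smul, Real.norm_of_nonneg ht.1.le]
    exact mul_le_mul_of_nonneg_right ht.2 (norm_nonneg _)
  have hdφ : Continuous fun x => fderiv ℝ φ x e :=
    (hφ.continuous_fderiv (by simp)).clm_apply continuous_const
  have hdc : HasCompactSupport fun x => fderiv ℝ φ x e := hc.fderiv_apply ℝ e
  obtain ⟨C₁, R₁, hC₁, hR₁⟩ := exists_bound_of_hasCompactSupport hφ.continuous hc
  obtain ⟨C₂, R₂, hC₂, hR₂⟩ := exists_bound_of_hasCompactSupport hdφ hdc
  have hint₁ := integrable_translate_mul_translate (μ := volume) (a := fun t => t • e)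
    (b := fun _ => 0) (S := h * ‖e‖) (h := h) hv hvi hφ.continuous.measurable hC₁ hR₁
    (by fun_prop) measurable_const (fun t ht => by rw [sub_zero]; exact hnorm t ht)
  have hint₂ := integrable_translate_mul_translate (μ := volume) (a := fun _ => 0)
    (b := fun t => -(t • e)) (S := h * ‖e‖) (h := h) hf hfi hdφ.measurable hC₂ hR₂
    measurable_const (by fun_prop)
    (fun t ht => by rw [zero_sub, neg_neg]; exact hnorm t ht)
  simp only [add_zero] at hint₁ hint₂
  simp only [smul_eq_mul]
  rw [integral_mul_translate_sub hfi hφ.continuous hc]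
  have hslice : ∀ t : ℝ, ∫ x, f x * fderiv ℝ φ (x + -(t • e)) e = -∫ x, v (x + t • e) * φ x := by
    intro t
    have hcφ' : HasCompactSupport fun x => φ (x + -(t • e)) :=
      hc.comp_homeomorph (Homeomorph.addRight (-(t • e)))
    have h1 := hfv.integral_eq (fun x => φ (x + -(t • e)))
      (hφ.comp (contDiff_id.add contDiff_const)) hcφ'
    simp only [fderiv_comp_add_right] at h1
    rw [h1, ← integral_add_right_eq_self (fun x => v x * φ (x + -(t • e))) (t • e)]
    simp
  calc ∫ x, f x * (φ (x + -(h • e)) - φ x)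
      = -∫ x, ∫ t in Set.Ioc 0 h, f x * fderiv ℝ φ (x + -(t • e)) e := by
        rw [← integral_neg]
        refine integral_congr_ae (Filter.Eventually.of_forall fun x => ?_)
        simp only [integral_const_mul, setIntegral_fderiv_translate hφ x e hh]
        ring
    _ = -∫ t in Set.Ioc 0 h, ∫ x, f x * fderiv ℝ φ (x + -(t • e)) e := by
        rw [integral_integral_swap hint₂]
    _ = ∫ t in Set.Ioc 0 h, ∫ x, v (x + t • e) * φ x := by
        simp only [hslice, integral_neg, neg_neg]
    _ = ∫ x, ∫ t in Set.Ioc 0 h, v (x + t • e) * φ x := by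
        rw [← integral_integral_swap hint₁]
    _ = ∫ x, φ x • ∫ t in Set.Ioc 0 h, v (x + t • e) := by
        simp only [integral_mul_const, smul_eq_mul, mul_comm (φ _)]

theorem setLIntegral_ball_translate (g : EuclideanSpace ℝ (Fin d) → ℝ≥0∞)
    (x a : EuclideanSpace ℝ (Fin d)) (r : ℝ) :
    ∫⁻ y in Metric.ball x r, g (y + a) = ∫⁻ y in Metric.ball (x + a) r, g y := by
  rw [← (measurePreserving_add_right volume a).setLIntegral_comp_preimage_emb
    (MeasurableEquiv.addRight a).measurableEmbedding g]
  congr 2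
  ext y
  simp

/-- Averaging an almost everywhere inequality over balls removes the exceptional set, so the
conclusion holds at every point. The two shifts `a`, `b` let one proof serve both directions of the
increment bound. -/
theorem hlMaximal_translate_le {f v : EuclideanSpace ℝ (Fin d) → ℝ}
    (hf : Measurable f) (hv : Measurable v) (a b e : EuclideanSpace ℝ (Fin d)) (h : ℝ)
    (hle : ∀ᵐ y, ‖f (y + a)‖ₑ ≤ ‖f (y + b)‖ₑ + ∫⁻ t in Set.Ioc 0 h, ‖v (y + t • e)‖ₑ)
    (x : EuclideanSpace ℝ (Fin d)) :
    hlMaximal f (x + a) ≤ hlMaximal f (x + b) + ∫⁻ t in Set.Ioc 0 h, hlMaximal v (x + t • e) := by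
  refine iSup₂_le fun r hr => ?_
  have hvol : ∀ z : EuclideanSpace ℝ (Fin d),
      volume (Metric.ball z r) = volume (Metric.ball x r) := fun z => by
    rw [Measure.addHaar_ball_center, Measure.addHaar_ball_center volume x]
  have hm : Measurable fun z : EuclideanSpace ℝ (Fin d) × ℝ => ‖v (z.1 + z.2 • e)‖ₑ := by fun_prop
  rw [hvol]
  set c := (volume (Metric.ball x r))⁻¹ with hc
  have hcfin : c ≠ ⊤ := ENNReal.inv_ne_top.2 (Metric.measure_ball_pos _ _ hr).ne'
  calc c * ∫⁻ y in Metric.ball (x + a) r, ‖f y‖ₑ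
      = c * ∫⁻ y in Metric.ball x r, ‖f (y + a)‖ₑ := by
        rw [setLIntegral_ball_translate fun y => ‖f y‖ₑ]
    _ ≤ c * ∫⁻ y in Metric.ball x r,
          (‖f (y + b)‖ₑ + ∫⁻ t in Set.Ioc 0 h, ‖v (y + t • e)‖ₑ) :=
        mul_le_mul_right (lintegral_mono_ae (ae_restrict_of_ae hle)) _
    _ = c * (∫⁻ y in Metric.ball (x + b) r, ‖f y‖ₑ)
          + ∫⁻ t in Set.Ioc 0 h, c * ∫⁻ y in Metric.ball (x + t • e) r, ‖v y‖ₑ := by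
        rw [lintegral_add_left (by fun_prop), mul_add,
          setLIntegral_ball_translate fun y => ‖f y‖ₑ,
          lintegral_lintegral_swap hm.aemeasurable, lintegral_const_mul' _ _ hcfin]
        simp only [setLIntegral_ball_translate fun y => ‖v y‖ₑ]
    _ ≤ _ := by
        gcongr with t
        · rw [hc, ← hvol (x + b)]
          exact average_le_hlMaximal f _ hr
        · rw [hc, ← hvol (x + t • e)]
          exact average_le_hlMaximal v _ hr

theorem HasWeakPartialDeriv.hlMaximal_translate_le {i : Fin d}
    {f v : EuclideanSpace ℝ (Fin d) → ℝ} (hfv : HasWeakPartialDeriv i f v) {h : ℝ} (hh : 0 ≤ h)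
    (x : EuclideanSpace ℝ (Fin d)) :
    hlMaximal f (x + h • EuclideanSpace.single i 1) ≤ hlMaximal f x
        + ∫⁻ t in Set.Ioc 0 h, hlMaximal v (x + t • EuclideanSpace.single i 1) ∧
      hlMaximal f x ≤ hlMaximal f (x + h • EuclideanSpace.single i 1)
        + ∫⁻ t in Set.Ioc 0 h, hlMaximal v (x + t • EuclideanSpace.single i 1) := by
  have hfm := hfv.locallyIntegrable.aestronglyMeasurable.aemeasurable
  have hvm := hfv.locallyIntegrable_deriv.aestronglyMeasurable.aemeasurable
  rw [hlMaximal_congr_ae hfm.ae_eq_mk, hlMaximal_congr_ae hvm.ae_eq_mk]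
  have hae := (hfv.congr_ae hfm.ae_eq_mk hvm.ae_eq_mk).ae_sub_eq_setIntegral hfm.measurable_mk
    hvm.measurable_mk hh
  set e : EuclideanSpace ℝ (Fin d) := EuclideanSpace.single i 1
  set F := hfm.mk f
  set V := hvm.mk v
  have hae' : ∀ᵐ y, ‖F (y + h • e) - F y‖ₑ ≤ ∫⁻ t in Set.Ioc 0 h, ‖V (y + t • e)‖ₑ := by
    filter_upwards [hae] with y hy
    rw [hy]
    exact enorm_integral_le_lintegral_enorm _
  constructor
  · have := _root_.hlMaximal_translate_le hfm.measurable_mk hvm.measurable_mk (h • e) 0 e h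
      (by
        filter_upwards [hae'] with y hy
        rw [add_zero]
        calc ‖F (y + h • e)‖ₑ = ‖F y + (F (y + h • e) - F y)‖ₑ := by congr 1; ring
          _ ≤ _ := (enorm_add_le _ _).trans (by gcongr)) x
    rwa [add_zero] at this
  · have := _root_.hlMaximal_translate_le hfm.measurable_mk hvm.measurable_mk 0 (h • e) e h
      (by
        filter_upwards [hae'] with y hy
        rw [add_zero]
        calc ‖F y‖ₑ = ‖F (y + h • e) - (F (y + h • e) - F y)‖ₑ := by congr 1; ring
          _ ≤ _ := enorm_sub_le.trans (by gcongr)) x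
    rwa [add_zero] at this

end WeakDerivative

/-- The bound makes `Λ` vanish on the kernel of `T`, so it descends to a bounded functional on the
range; Hahn–Banach extends it and Riesz represents it. The range need not be closed, nor `T`
injective. -/
theorem exists_inner_eq_of_abs_le {V H : Type*} [AddCommGroup V] [Module ℝ V]
    [NormedAddCommGroup H] [InnerProductSpace ℝ H] [CompleteSpace H] (T : V →ₗ[ℝ] H)
    (Λ : V →ₗ[ℝ] ℝ) (C : ℝ) (h : ∀ v, |Λ v| ≤ C * ‖T v‖) :
    ∃ w : H, ∀ v, Λ v = inner ℝ w (T v) := by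
  obtain ⟨s, hs⟩ := T.rangeRestrict.exists_rightInverse_of_surjective T.range_rangeRestrict
  have hTs : ∀ y : T.range, T (s y) = y := fun y =>
    congrArg Subtype.val (LinearMap.congr_fun hs y)
  have hΛ : ∀ v, Λ (s (T.rangeRestrict v)) = Λ v := by
    intro v
    have h0 := h (s (T.rangeRestrict v) - v)
    have hT : T (s (T.rangeRestrict v) - v) = 0 := by
      rw [map_sub, hTs]
      exact sub_self _
    rw [hT, norm_zero, mul_zero, map_sub] at h0
    exact sub_eq_zero.1 (abs_nonpos_iff.1 h0)
  let L : StrongDual ℝ T.range := (Λ ∘ₗ s).mkContinuous C fun y => by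
    have := h (s y)
    rwa [hTs] at this
  obtain ⟨G, hG, -⟩ := exists_extension_norm_eq T.range L
  refine ⟨(InnerProductSpace.toDual ℝ H).symm G, fun v => ?_⟩
  rw [InnerProductSpace.toDual_symm_apply, ← hΛ v]
  exact (hG (T.rangeRestrict v)).symm

theorem setLIntegral_mul_lt_top_of_isCompact {E : Type*} [TopologicalSpace E] [T2Space E]
    [MeasurableSpace E] [OpensMeasurableSpace E] {μ : Measure E} {k : E → ℝ≥0∞}
    (hk : ∫⁻ x, k x ∂μ ≠ ⊤)
    {q : E → ℝ≥0} (hq : Continuous q) {K : Set E} (hK : IsCompact K) :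
    ∫⁻ x in K, q x * k x ∂μ < ⊤ := by
  obtain ⟨C, hC⟩ := hK.bddAbove_image hq.continuousOn
  calc ∫⁻ x in K, q x * k x ∂μ ≤ ∫⁻ x in K, C * k x ∂μ := by
        refine setLIntegral_mono' hK.measurableSet fun x hx => ?_
        gcongr
        exact hC (Set.mem_image_of_mem _ hx)
    _ = C * ∫⁻ x in K, k x ∂μ := lintegral_const_mul' _ _ ENNReal.coe_ne_top
    _ < ⊤ := by
        have : ∫⁻ x in K, k x ∂μ < ⊤ := (setLIntegral_le_lintegral _ _).trans_lt hk.lt_top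
        finiteness

/-! ### From increment bounds to a weak derivative -/

section Density

variable {E : Type*} [NormedAddCommGroup E] [InnerProductSpace ℝ E] [FiniteDimensional ℝ E]
  [MeasurableSpace E] [BorelSpace E] {μ : Measure E} [μ.IsAddHaarMeasure]

/-- Testing with mollifiers centred at `x` compares the convolutions of `u` and `g`, which converge
to the functions almost everywhere. The fixed ratio `rOut = 2 * rIn` is what that convergence
requires. -/
theorem ae_le_of_forall_integral_mul_le {u g : E → ℝ} (hu : LocallyIntegrable u μ)
    (hg : LocallyIntegrable g μ)
    (h : ∀ φ : E → ℝ, ContDiff ℝ ∞ φ → HasCompactSupport φ → (∀ x, 0 ≤ φ x) →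
      ∫ x, φ x * u x ∂μ ≤ ∫ x, φ x * g x ∂μ) :
    ∀ᵐ x ∂μ, u x ≤ g x := by
  let ψ : ℕ → ContDiffBump (0 : E) := fun n =>
    { rIn := 1 / ((n : ℝ) + 1)
      rOut := 2 * (1 / ((n : ℝ) + 1))
      rIn_pos := by positivity
      rIn_lt_rOut := by
        have : (0 : ℝ) < 1 / ((n : ℝ) + 1) := by positivity
        linarith }
  have hψ : Filter.Tendsto (fun n => (ψ n).rOut) Filter.atTop (nhds 0) := by
    have := (tendsto_one_div_add_atTop_nhds_zero_nat (𝕜 := ℝ)).const_mul 2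
    rwa [mul_zero] at this
  have hK : ∀ᶠ n in Filter.atTop, (ψ n).rOut ≤ 2 * (ψ n).rIn :=
    Filter.Eventually.of_forall fun n => le_rfl
  filter_upwards [ContDiffBump.ae_convolution_tendsto_right_of_locallyIntegrable hψ hK hu,
    ContDiffBump.ae_convolution_tendsto_right_of_locallyIntegrable hψ hK hg] with x h1 h2
  refine le_of_tendsto_of_tendsto' h1 h2 fun n => ?_
  have hconv : ∀ k : E → ℝ,
      convolution ((ψ n).normed μ) k (ContinuousLinearMap.lsmul ℝ ℝ) μ x
        = ∫ y, (ψ n).normed μ (x - y) * k y ∂μ := fun k => by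
    rw [convolution_eq_swap]
    simp
  rw [hconv, hconv]
  refine h _ ((ψ n).contDiff_normed.comp (contDiff_const.sub contDiff_id)) ?_
    fun y => (ψ n).nonneg_normed _
  exact (ψ n).hasCompactSupport_normed.comp_homeomorph (Homeomorph.subLeft x)

/-- The difference quotient passes from `φ` to `F`, where the increment bound applies. The
translation of `g` is then moved back onto `φ`, where the Lipschitz constant makes the error `O(h)`;
so only local integrability of `g` is needed. -/
theorem enorm_integral_mul_fderiv_le {F : E → ℝ} (hF : LocallyIntegrable F μ) {g : E → ℝ≥0∞}
    (hgm : Measurable g) (hg : ∀ K, IsCompact K → ∫⁻ x in K, g x ∂μ < ⊤) (e : E)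
    (hFg : ∀ h : ℝ, 0 ≤ h →
      ∀ᵐ x ∂μ, ‖F (x + h • e) - F x‖ₑ ≤ ∫⁻ t in Set.Ioc 0 h, g (x + t • e))
    {φ : E → ℝ} (hφ : ContDiff ℝ ∞ φ) (hc : HasCompactSupport φ) :
    ‖∫ x, F x * fderiv ℝ φ x e ∂μ‖ₑ ≤ ∫⁻ x, ‖φ x‖ₑ * g x ∂μ := by
  obtain ⟨L, hL⟩ := hφ.lipschitzWith_of_hasCompactSupport hc (by simp)
  obtain ⟨-, R, -, hR⟩ := exists_bound_of_hasCompactSupport hφ.continuous hc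
  -- Contains the supports of all translates of `φ` by `h • e` with `0 ≤ h ≤ 1`, so cutting `F` off
  -- to `K` changes none of the integrals.
  set K : Set E := Metric.closedBall 0 (R + ‖e‖) with hK
  have hKm : MeasurableSet K := Metric.isClosed_closedBall.measurableSet
  have hRK : ∀ x ∉ K, ∀ h ∈ Set.Icc (0 : ℝ) 1, φ (x + h • -e) = 0 := by
    intro x hx h hh
    refine hR _ ?_
    rw [hK, mem_closedBall_zero_iff, not_le] at hx
    have h1 : ‖h • -e‖ ≤ ‖e‖ := by
      rw [norm_smul, norm_neg, Real.norm_of_nonneg hh.1]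
      exact mul_le_of_le_one_left (norm_nonneg _) hh.2
    have h2 := norm_sub_norm_le x (-(h • -e))
    rw [sub_neg_eq_add, norm_neg] at h2
    linarith
  have hRK0 : ∀ x ∉ K, φ x = 0 := fun x hx => by
    simpa using hRK x hx 0 (by simp)
  set A := ∫⁻ x in K, g x ∂μ with hA
  have hAfin : A ≠ ⊤ := (hg K (isCompact_closedBall 0 (R + ‖e‖))).ne
  have hlim := (LipschitzWith.integral_inv_smul_sub_mul_tendsto_integral_lineDeriv_mul hL
    ((hF.integrableOn_isCompact (isCompact_closedBall 0 (R + ‖e‖))).integrable_indicator hKm)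
    (-e)).enorm
  have hlimit : ‖∫ x, lineDeriv ℝ φ x (-e) * K.indicator F x ∂μ‖ₑ
      = ‖∫ x, F x * fderiv ℝ φ x e ∂μ‖ₑ := by
    rw [← enorm_neg (∫ x, F x * fderiv ℝ φ x e ∂μ), ← integral_neg]
    congr 1
    refine integral_congr_ae (Filter.Eventually.of_forall fun x => ?_)
    have hd : lineDeriv ℝ φ x (-e) = -fderiv ℝ φ x e := by
      rw [((hφ.differentiable (by simp)) x).lineDeriv_eq_fderiv, map_neg]
    simp only [hd]
    by_cases hx : x ∈ K
    · rw [Set.indicator_of_mem hx]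
      ring
    · have h0 : fderiv ℝ φ x e = 0 := by
        have hzero : φ =ᶠ[nhds x] fun _ => 0 := by
          filter_upwards [Metric.isClosed_closedBall.isOpen_compl.mem_nhds hx] with y hy
          exact hRK0 y hy
        rw [hzero.fderiv_eq]
        simp
      simp [h0]
  rw [hlimit] at hlim
  have hright : Filter.Tendsto
      (fun h : ℝ => ∫⁻ x, ‖φ x‖ₑ * g x ∂μ + ENNReal.ofReal (L * (h * ‖e‖)) * A)
      (nhdsWithin 0 (Set.Ioi 0)) (nhds (∫⁻ x, ‖φ x‖ₑ * g x ∂μ)) := by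
    have h1 : Filter.Tendsto (fun h : ℝ => ENNReal.ofReal (L * (h * ‖e‖)))
        (nhdsWithin 0 (Set.Ioi 0)) (nhds 0) := by
      have : Continuous fun h : ℝ => ENNReal.ofReal (L * (h * ‖e‖)) :=
        ENNReal.continuous_ofReal.comp (by fun_prop)
      simpa using (this.tendsto 0).mono_left nhdsWithin_le_nhds
    simpa using (ENNReal.Tendsto.mul_const h1 (Or.inr hAfin)).const_add
      (∫⁻ x, ‖φ x‖ₑ * g x ∂μ)
  refine le_of_tendsto_of_tendsto hlim hright ?_
  filter_upwards [Ioc_mem_nhdsGT (show (0 : ℝ) < 1 by norm_num)] with h hh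
  have h0 : 0 < h := hh.1
  have hquot : ∫ x, h⁻¹ • (φ (x + h • -e) - φ x) * K.indicator F x ∂μ
      = h⁻¹ * ∫ x, φ x * (F (x + h • e) - F x) ∂μ := by
    rw [integral_mul_translate_sub hF hφ.continuous hc, ← integral_const_mul]
    refine integral_congr_ae (Filter.Eventually.of_forall fun x => ?_)
    simp only [smul_neg, smul_eq_mul]
    by_cases hx : x ∈ K
    · rw [Set.indicator_of_mem hx]
      ring
    · have := hRK x hx h ⟨h0.le, hh.2⟩
      rw [smul_neg] at this
      rw [this, hRK0 x hx]
      simp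
  have hpt : ∀ t ∈ Set.Ioc 0 h, ∀ x,
      ‖φ (x + t • -e)‖ₑ ≤ ‖φ x‖ₑ + K.indicator (fun _ => ENNReal.ofReal (L * (h * ‖e‖))) x := by
    intro t ht x
    by_cases hx : x ∈ K
    · rw [Set.indicator_of_mem hx]
      have h1 : ‖φ (x + t • -e)‖ ≤ ‖φ x‖ + L * (h * ‖e‖) := by
        have h2 := hL.dist_le_mul (x + t • -e) x
        rw [dist_eq_norm, dist_eq_norm, add_sub_cancel_left, norm_smul, norm_neg,
          Real.norm_of_nonneg ht.1.le] at h2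
        have h3 := norm_sub_norm_le (φ (x + t • -e)) (φ x)
        have h4 : L * (t * ‖e‖) ≤ L * (h * ‖e‖) := by
          gcongr
          exact ht.2
        linarith
      rw [← ofReal_norm, ← ofReal_norm, ← ENNReal.ofReal_add (norm_nonneg _) (by positivity)]
      exact ENNReal.ofReal_le_ofReal h1
    · rw [hRK x hx t ⟨ht.1.le, ht.2.trans hh.2⟩]
      simp
  have hslice : ∀ t ∈ Set.Ioc 0 h, ∫⁻ x, ‖φ x‖ₑ * g (x + t • e) ∂μ
      ≤ ∫⁻ x, ‖φ x‖ₑ * g x ∂μ + ENNReal.ofReal (L * (h * ‖e‖)) * A := by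
    intro t ht
    calc ∫⁻ x, ‖φ x‖ₑ * g (x + t • e) ∂μ
        = ∫⁻ x, ‖φ (x + t • -e)‖ₑ * g x ∂μ := by
          rw [← lintegral_add_right_eq_self (fun x => ‖φ (x + t • -e)‖ₑ * g x) (t • e)]
          simp
      _ ≤ ∫⁻ x, (‖φ x‖ₑ * g x
            + K.indicator (fun x => ENNReal.ofReal (L * (h * ‖e‖)) * g x) x) ∂μ := by
          refine lintegral_mono fun x => ?_
          refine (mul_le_mul_left (hpt t ht x) _).trans ?_
          rw [add_mul]
          gcongr
          by_cases hx : x ∈ K <;> simp [hx]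
      _ = _ := by
          have := hφ.continuous.measurable
          rw [lintegral_add_left (by fun_prop), lintegral_indicator hKm,
            lintegral_const_mul' _ _ ENNReal.ofReal_ne_top]
  rw [hquot, enorm_mul]
  have hgm2 : Measurable fun z : E × ℝ => ‖φ z.1‖ₑ * g (z.1 + z.2 • e) := by
    have := hφ.continuous.measurable
    fun_prop
  calc ‖h⁻¹‖ₑ * ‖∫ x, φ x * (F (x + h • e) - F x) ∂μ‖ₑ
      ≤ ‖h⁻¹‖ₑ * ∫⁻ x, ‖φ x‖ₑ * ‖F (x + h • e) - F x‖ₑ ∂μ := by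
        gcongr
        refine (enorm_integral_le_lintegral_enorm _).trans_eq ?_
        simp only [enorm_mul]
    _ ≤ ‖h⁻¹‖ₑ * ∫⁻ x, (∫⁻ t in Set.Ioc 0 h, ‖φ x‖ₑ * g (x + t • e)) ∂μ := by
        refine mul_le_mul_right (lintegral_mono_ae ?_) _
        filter_upwards [hFg h h0.le] with x hx
        rw [lintegral_const_mul' _ _ enorm_ne_top]
        gcongr
    _ = ‖h⁻¹‖ₑ * ∫⁻ t in Set.Ioc 0 h, ∫⁻ x, ‖φ x‖ₑ * g (x + t • e) ∂μ := by
        rw [lintegral_lintegral_swap hgm2.aemeasurable]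
    _ ≤ ‖h⁻¹‖ₑ * ∫⁻ _ in Set.Ioc 0 h,
          (∫⁻ x, ‖φ x‖ₑ * g x ∂μ + ENNReal.ofReal (L * (h * ‖e‖)) * A) :=
        mul_le_mul_right (setLIntegral_mono' measurableSet_Ioc hslice) _
    _ = _ := by
        rw [setLIntegral_const, Real.volume_Ioc, sub_zero,
          mul_comm _ (ENNReal.ofReal h), ← mul_assoc, Real.enorm_of_nonneg (by positivity),
          ← ENNReal.ofReal_mul (by positivity), inv_mul_cancel₀ h0.ne', ENNReal.ofReal_one, one_mul]

/-- The weight makes Hilbert space methods available. With `m = (g / ρ) dx`, the bound `∫ |φ| g = ∫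
ρ |φ| dm` and Cauchy–Schwarz give continuity in `L²(m)`, since `∫ ρ² dm = ∫ ρ g` is finite. The
representing vector times `-g / ρ` is the derivative; the Cauchy–Schwarz loss does not matter,
because the sharp bound by `g` is recovered afterwards from the hypothesis on `φ`. -/
theorem exists_integral_mul_fderiv_eq {F : E → ℝ} (hF : LocallyIntegrable F μ) {g ρ : E → ℝ≥0}
    (hgm : Measurable g) (hρ : Continuous ρ) (hρ0 : ∀ x, ρ x ≠ 0)
    (hgρ : ∫⁻ x, (ρ x * g x : ℝ≥0∞) ∂μ ≠ ⊤) (e : E)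
    (hFg : ∀ φ : E → ℝ, ContDiff ℝ ∞ φ → HasCompactSupport φ →
      ‖∫ x, F x * fderiv ℝ φ x e ∂μ‖ₑ ≤ ∫⁻ x, ‖φ x‖ₑ * g x ∂μ) :
    ∃ w : E → ℝ, LocallyIntegrable w μ ∧ (∀ᵐ x ∂μ, ‖w x‖ₑ ≤ g x) ∧
      ∀ φ : E → ℝ, ContDiff ℝ ∞ φ → HasCompactSupport φ →
        ∫ x, F x * fderiv ℝ φ x e ∂μ = -∫ x, w x * φ x ∂μ := by
  have hρm := hρ.measurable
  have hgi : LocallyIntegrable (fun x => (g x : ℝ)) μ := by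
    rw [locallyIntegrable_iff]
    intro K hK
    refine ⟨by fun_prop, ?_⟩
    have := setLIntegral_mul_lt_top_of_isCompact hgρ (hρ.inv₀ hρ0) hK
    refine lt_of_eq_of_lt (lintegral_congr fun x => ?_) this
    rw [Pi.inv_apply, ← mul_assoc, ← ENNReal.coe_mul, inv_mul_cancel₀ (hρ0 x)]
    simp
  set δ : E → ℝ≥0 := fun x => g x * (ρ x)⁻¹ with hδ
  have hδm : Measurable δ := by fun_prop
  set m : Measure E := μ.withDensity fun x => (δ x : ℝ≥0∞) with hm
  -- On compacts `g / ρ = ρ⁻² (ρ g)` with `ρ⁻²` bounded; hence test functions lie in `L²(m)`.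
  have hmK : ∀ K : Set E, IsCompact K → m K < ⊤ := by
    intro K hK
    rw [hm, withDensity_apply _ hK.measurableSet]
    have := setLIntegral_mul_lt_top_of_isCompact hgρ ((hρ.inv₀ hρ0).pow 2) hK
    refine lt_of_eq_of_lt (lintegral_congr fun x => ?_) this
    simp only [Pi.pow_apply, Pi.inv_apply, hδ]
    norm_cast
    field_simp [hρ0 x]
  have : IsFiniteMeasureOnCompacts m := ⟨hmK⟩
  let S : Submodule ℝ (E → ℝ) :=
    { carrier := {φ | ContDiff ℝ ∞ φ ∧ HasCompactSupport φ}
      add_mem' := fun ha hb => ⟨ha.1.add hb.1, ha.2.add hb.2⟩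
      zero_mem' := ⟨contDiff_const, HasCompactSupport.zero⟩
      smul_mem' := fun c φ hφ => ⟨hφ.1.const_smul c, hφ.2.smul_left (f := fun _ => c)⟩ }
  have hmem : ∀ φ : S, MemLp (φ : E → ℝ) 2 m := fun φ =>
    φ.2.1.continuous.memLp_of_hasCompactSupport φ.2.2
  have hint : ∀ φ : S, Integrable (fun x => F x * fderiv ℝ (φ : E → ℝ) x e) μ := fun φ =>
    hF.integrable_smul_right_of_hasCompactSupport
      ((φ.2.1.continuous_fderiv (by simp)).clm_apply continuous_const) (φ.2.2.fderiv_apply ℝ e)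
  have hdiff : ∀ (φ : S) (x : E), DifferentiableAt ℝ (φ : E → ℝ) x := fun φ x =>
    φ.2.1.differentiable (by simp) x
  let T : S →ₗ[ℝ] Lp ℝ 2 m :=
    { toFun := fun φ => (hmem φ).toLp φ
      map_add' := fun φ ψ => MemLp.toLp_add (hmem φ) (hmem ψ)
      map_smul' := fun c φ => MemLp.toLp_const_smul c (hmem φ) }
  let Λ : S →ₗ[ℝ] ℝ :=
    { toFun := fun φ => ∫ x, F x * fderiv ℝ (φ : E → ℝ) x e ∂μ
      map_add' := fun φ ψ => by
        rw [← integral_add (hint φ) (hint ψ)]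
        refine integral_congr_ae (Filter.Eventually.of_forall fun x => ?_)
        simp only [Submodule.coe_add, fderiv_add (hdiff φ x) (hdiff ψ x),
          add_apply, mul_add]
      map_smul' := fun c φ => by
        rw [RingHom.id_apply, smul_eq_mul, ← integral_const_mul]
        refine integral_congr_ae (Filter.Eventually.of_forall fun x => ?_)
        simp only [Submodule.coe_smul, fderiv_const_smul (hdiff φ x),
          smul_apply, smul_eq_mul]
        ring }
  set A : ℝ≥0∞ := (∫⁻ x, (ρ x : ℝ≥0∞) ^ (2 : ℝ) ∂m) ^ (1 / (2 : ℝ)) with hA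
  have hAfin : A ≠ ⊤ := by
    refine ENNReal.rpow_ne_top_of_nonneg (by norm_num) ?_
    rw [hm, lintegral_withDensity_eq_lintegral_mul _ (by fun_prop) (by fun_prop)]
    convert hgρ using 3 with x
    simp only [Pi.mul_apply, hδ, ENNReal.rpow_ofNat]
    norm_cast
    field_simp [hρ0 x]
  have hbound : ∀ φ : S, |Λ φ| ≤ A.toReal * ‖T φ‖ := by
    intro φ
    have hφm : Measurable (φ : E → ℝ) := φ.2.1.continuous.measurable
    have h1 : ‖Λ φ‖ₑ ≤ A * eLpNorm (φ : E → ℝ) 2 m := by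
      calc ‖Λ φ‖ₑ ≤ ∫⁻ x, ‖(φ : E → ℝ) x‖ₑ * g x ∂μ := hFg φ φ.2.1 φ.2.2
        _ = ∫⁻ x, ρ x * ‖(φ : E → ℝ) x‖ₑ ∂m := by
            rw [hm, lintegral_withDensity_eq_lintegral_mul _ (by fun_prop) (by fun_prop)]
            refine lintegral_congr fun x => ?_
            rw [Pi.mul_apply, ← mul_assoc, ← ENNReal.coe_mul, hδ, mul_comm]
            congr 2
            field_simp [hρ0 x]
        _ ≤ A * (∫⁻ x, ‖(φ : E → ℝ) x‖ₑ ^ (2 : ℝ) ∂m) ^ (1 / (2 : ℝ)) :=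
            ENNReal.lintegral_mul_le_Lp_mul_Lq m Real.HolderConjugate.two_two
              (by fun_prop) (by fun_prop)
        _ = A * eLpNorm (φ : E → ℝ) 2 m := by
            rw [eLpNorm_eq_lintegral_rpow_enorm_toReal (by norm_num) (by norm_num)]
            simp
    have h2 := ENNReal.toReal_mono
      (ENNReal.mul_ne_top hAfin (hmem φ).eLpNorm_lt_top.ne) h1
    rw [ENNReal.toReal_mul] at h2
    simpa [T, Lp.norm_toLp] using h2
  obtain ⟨w₀, hw₀⟩ := exists_inner_eq_of_abs_le T Λ A.toReal hbound
  have hwint : LocallyIntegrable (fun x => -(δ x • w₀ x)) μ := by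
    rw [locallyIntegrable_iff]
    intro K hK
    have h1 : IntegrableOn w₀ K m :=
      ((Lp.memLp w₀).locallyIntegrable (by norm_num)).integrableOn_isCompact hK
    have hres : m.restrict K = (μ.restrict K).withDensity fun x => (δ x : ℝ≥0∞) :=
      restrict_withDensity hK.measurableSet _
    rw [IntegrableOn, hres, integrable_withDensity_iff_integrable_smul hδm] at h1
    exact h1.neg
  have heq : ∀ φ : E → ℝ, ContDiff ℝ ∞ φ → HasCompactSupport φ →
      ∫ x, F x * fderiv ℝ φ x e ∂μ = -∫ x, -(δ x • w₀ x) * φ x ∂μ := by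
    intro φ hφ hc
    have h1 := hw₀ ⟨φ, hφ, hc⟩
    rw [L2.inner_def] at h1
    have h2 : ∫ x, inner ℝ (w₀ x) (T ⟨φ, hφ, hc⟩ x) ∂m = ∫ x, w₀ x * φ x ∂m := by
      refine integral_congr_ae ?_
      filter_upwards [(hmem ⟨φ, hφ, hc⟩).coeFn_toLp] with x hx
      have hx : T ⟨φ, hφ, hc⟩ x = φ x := hx
      rw [hx]
      simp [mul_comm]
    refine (h1.trans (h2.trans (integral_withDensity_eq_integral_smul hδm _))).trans ?_
    rw [← integral_neg]
    refine integral_congr_ae (Filter.Eventually.of_forall fun x => ?_)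
    simp only [NNReal.smul_def, smul_eq_mul]
    ring
  refine ⟨fun x => -(δ x • w₀ x), hwint, ?_, heq⟩
  set w : E → ℝ := fun x => -(δ x • w₀ x) with hw
  -- For `φ ≥ 0` the domination hypothesis bounds both `w` and `-w` by `g` in the weak sense.
  have habs : ∀ φ : E → ℝ, ContDiff ℝ ∞ φ → HasCompactSupport φ → (∀ x, 0 ≤ φ x) →
      |∫ x, φ x * w x ∂μ| ≤ ∫ x, φ x * g x ∂μ := by
    intro φ hφ hc h0
    have h1 := hFg φ hφ hc
    have hφm := hφ.continuous.measurable
    have hφg : Integrable (fun x => φ x * (g x : ℝ)) μ :=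
      hgi.integrable_smul_left_of_hasCompactSupport hφ.continuous hc
    have h2 : ∫⁻ x, ‖φ x‖ₑ * g x ∂μ = ENNReal.ofReal (∫ x, φ x * g x ∂μ) := by
      rw [ofReal_integral_eq_lintegral_ofReal hφg
        (Filter.Eventually.of_forall fun x => mul_nonneg (h0 x) (g x).2)]
      refine lintegral_congr fun x => ?_
      rw [ENNReal.ofReal_mul (h0 x), Real.enorm_of_nonneg (h0 x), ENNReal.ofReal_coe_nnreal]
    rw [heq φ hφ hc, enorm_neg, h2, Real.enorm_eq_ofReal_abs, ENNReal.ofReal_le_ofReal_iff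
      (integral_nonneg fun x => mul_nonneg (h0 x) (g x).coe_nonneg)] at h1
    simpa only [mul_comm] using h1
  have hle₁ := ae_le_of_forall_integral_mul_le hwint hgi fun φ hφ hc h0 =>
    (le_abs_self _).trans (habs φ hφ hc h0)
  have hle₂ := ae_le_of_forall_integral_mul_le hwint.neg hgi fun φ hφ hc h0 => by
    refine le_trans ?_ (habs φ hφ hc h0)
    simp only [Pi.neg_apply, mul_neg, integral_neg]
    exact neg_le_abs _
  filter_upwards [hle₁, hle₂] with x h1 h2
  rw [Real.enorm_eq_ofReal_abs, ← ENNReal.ofReal_coe_nnreal]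
  exact ENNReal.ofReal_le_ofReal (abs_le'.2 ⟨h1, h2⟩)

end Density

/-! ### The weak gradient of the maximal function and the Sobolev bound -/

section SobolevBound

/-- The weight `(1 + ‖x‖) ^ (-(n + 1))`, with `n` the dimension, is integrable and at most `1`, so
`ρ g ≤ ρ + g ^ q` upon splitting at `g = 1`. -/
theorem exists_continuous_lintegral_mul_ne_top {E : Type*} [NormedAddCommGroup E] [NormedSpace ℝ E]
    [FiniteDimensional ℝ E] [MeasurableSpace E] [BorelSpace E] (μ : Measure E)
    [μ.IsAddHaarMeasure] : ∃ ρ : E → ℝ≥0, Continuous ρ ∧ (∀ x, ρ x ≠ 0) ∧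
      ∀ (g : E → ℝ≥0∞) (q : ℝ), 1 ≤ q → ∫⁻ x, g x ^ q ∂μ ≠ ⊤ → ∫⁻ x, ρ x * g x ∂μ ≠ ⊤ := by
  set s : ℝ := Module.finrank ℝ E + 1 with hs
  have hpos : ∀ x : E, 0 < (1 + ‖x‖) ^ (-s) := fun x => by positivity
  have hle : ∀ x : E, (1 + ‖x‖) ^ (-s) ≤ 1 := fun x =>
    Real.rpow_le_one_of_one_le_of_nonpos (by simp) (by rw [hs]; linarith [(Nat.cast_nonneg _ :
      (0 : ℝ) ≤ Module.finrank ℝ E)])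
  have hcont : Continuous fun x : E => ((1 + ‖x‖) ^ (-s)).toNNReal :=
    continuous_real_toNNReal.comp ((by fun_prop : Continuous fun x : E => 1 + ‖x‖).rpow_const
      fun x => Or.inl (by positivity))
  refine ⟨fun x => ((1 + ‖x‖) ^ (-s)).toNNReal, hcont, fun x => by simpa using hpos x,
    fun g q hq hg => ?_⟩
  have hint : ∫⁻ x : E, (((1 + ‖x‖) ^ (-s)).toNNReal : ℝ≥0∞) ∂μ < ⊤ := by
    have := (integrable_one_add_norm (μ := μ) (E := E) (r := s) (by simp [hs])).lintegral_lt_top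
    exact this
  refine ne_of_lt ?_
  calc ∫⁻ x, (((1 + ‖x‖) ^ (-s)).toNNReal : ℝ≥0∞) * g x ∂μ
      ≤ ∫⁻ x, ((((1 + ‖x‖) ^ (-s)).toNNReal : ℝ≥0∞) + g x ^ q) ∂μ := by
        refine lintegral_mono fun x => ?_
        rcases le_total (g x) 1 with h | h
        · exact (mul_le_of_le_one_right' h).trans le_self_add
        · refine le_trans ?_ le_add_self
          have h1 : (((1 + ‖x‖) ^ (-s)).toNNReal : ℝ≥0∞) ≤ 1 := by
            exact_mod_cast Real.toNNReal_le_one.2 (hle x)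
          exact (mul_le_of_le_one_left' h1).trans (ENNReal.le_rpow_self_of_one_le h hq)
    _ = ∫⁻ x, (((1 + ‖x‖) ^ (-s)).toNNReal : ℝ≥0∞) ∂μ + ∫⁻ x, g x ^ q ∂μ :=
        lintegral_add_left (by exact hcont.measurable.coe_nnreal_ennreal) _
    _ < ⊤ := ENNReal.add_lt_top.2 ⟨hint, hg.lt_top⟩

variable {d : ℕ} {p : ℝ≥0∞}

/-- Applies the density argument with `F = Mf` and `g = Mv`; the `L^p` bound for `Mv` supplies the
integrability of `ρ g`. -/
theorem exists_hasWeakPartialDeriv_hlMaximalReal (hp : 1 < p) (hp_top : p < ⊤) {i : Fin d}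
    {f v : EuclideanSpace ℝ (Fin d) → ℝ} (hf : MemLp f p volume) (hv : MemLp v p volume)
    (hfv : HasWeakPartialDeriv i f v) :
    ∃ w, HasWeakPartialDeriv i (hlMaximalReal f) w ∧ ∀ᵐ x, ‖w x‖ₑ ≤ hlMaximal v x := by
  set e : EuclideanSpace ℝ (Fin d) := EuclideanSpace.single i 1 with he
  obtain ⟨C, hC⟩ := exists_eLpNorm_hlMaximalReal_le d hp hp_top
  obtain ⟨ρ, hρ, hρ0, hρint⟩ := exists_continuous_lintegral_mul_ne_top
    (volume : Measure (EuclideanSpace ℝ (Fin d)))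
  have hq : 1 ≤ p.toReal := by
    rw [← ENNReal.toReal_one]
    exact ENNReal.toReal_mono hp_top.ne hp.le
  have hMf : LocallyIntegrable (hlMaximalReal f) volume := (hC f hf).1.locallyIntegrable hp.le
  have hMm : Measurable (hlMaximal v) := measurable_hlMaximal hv.aestronglyMeasurable.aemeasurable
  have hgp : ∫⁻ x, hlMaximal v x ^ p.toReal ≠ ⊤ := by
    refine ne_of_eq_of_ne (lintegral_congr_ae ?_) (lintegral_rpow_enorm_lt_top_of_eLpNorm_lt_top
      (zero_lt_one.trans hp).ne' hp_top.ne (hC v hv).1.eLpNorm_lt_top).ne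
    filter_upwards [enorm_hlMaximalReal_ae_eq hp.le hp_top.ne hv] with x hx
    rw [hx]
  have hgρ := hρint (hlMaximal v) p.toReal hq hgp
  have hgloc : ∀ K, IsCompact K → ∫⁻ x in K, hlMaximal v x < ⊤ := by
    intro K hK
    refine lt_of_eq_of_lt (lintegral_congr fun x => ?_)
      (setLIntegral_mul_lt_top_of_isCompact hgρ (hρ.inv₀ hρ0) hK)
    rw [Pi.inv_apply, ← mul_assoc, ← ENNReal.coe_mul, inv_mul_cancel₀ (hρ0 x), ENNReal.coe_one,
      one_mul]
  have hfin := ae_hlMaximal_lt_top hp.le hp_top.ne hf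
  have hsub : ∀ h : ℝ, 0 ≤ h → ∀ᵐ x, ‖hlMaximalReal f (x + h • e) - hlMaximalReal f x‖ₑ
      ≤ ∫⁻ t in Set.Ioc 0 h, hlMaximal v (x + t • e) := by
    intro h hh
    have hfin' : ∀ᵐ x, hlMaximal f (x + h • e) < ⊤ :=
      (measurePreserving_add_right volume (h • e)).quasiMeasurePreserving.ae hfin
    filter_upwards [hfin, hfin'] with x h1 h2
    obtain ⟨h3, h4⟩ := hfv.hlMaximal_translate_le hh x
    rw [← he] at h3 h4
    set I := ∫⁻ t in Set.Ioc 0 h, hlMaximal v (x + t • e)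
    -- The integral along the segment may be infinite at some `x`; the bound is then trivial, and
    -- otherwise everything can be moved to real numbers.
    rcases eq_or_ne I ⊤ with hI | hI
    · rw [hI]
      exact le_top
    have h5 := ENNReal.toReal_mono (by finiteness) h3
    have h6 := ENNReal.toReal_mono (by finiteness) h4
    rw [ENNReal.toReal_add h1.ne hI] at h5
    rw [ENNReal.toReal_add h2.ne hI] at h6
    rw [Real.enorm_eq_ofReal_abs]
    refine ENNReal.ofReal_le_of_le_toReal (abs_le.2 ⟨?_, ?_⟩) <;>
      simp only [hlMaximalReal] <;> linarith
  have hae : (fun x => ((hlMaximal v x).toNNReal : ℝ≥0∞)) =ᵐ[volume] hlMaximal v := by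
    filter_upwards [ae_hlMaximal_lt_top hp.le hp_top.ne hv] with x hx
    exact ENNReal.coe_toNNReal hx.ne
  obtain ⟨w, hwi, hwle, hweq⟩ := exists_integral_mul_fderiv_eq hMf hMm.ennreal_toNNReal hρ hρ0
    (by
      refine ne_of_eq_of_ne (lintegral_congr_ae ?_) hgρ
      filter_upwards [hae] with x hx
      rw [hx]) e
    (fun φ hφ hc => by
      refine (enorm_integral_mul_fderiv_le hMf hMm hgloc e hsub hφ hc).trans_eq
        (lintegral_congr_ae ?_)
      filter_upwards [hae] with x hx
      rw [hx])
  refine ⟨w, ⟨hMf, hwi, hweq⟩, ?_⟩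
  filter_upwards [hwle, hae] with x h1 h2
  rwa [← h2]

theorem MeasureTheory.MemLp.euclidean_apply
    {G : EuclideanSpace ℝ (Fin d) → EuclideanSpace ℝ (Fin d)}
    (hG : MemLp G p volume) (i : Fin d) : MemLp (fun x => G x i) p volume :=
  (EuclideanSpace.proj i : EuclideanSpace ℝ (Fin d) →L[ℝ] ℝ).comp_memLp' hG

theorem eLpNorm_euclidean_apply_le (G : EuclideanSpace ℝ (Fin d) → EuclideanSpace ℝ (Fin d))
    (i : Fin d) : eLpNorm (fun x => G x i) p volume ≤ eLpNorm G p volume :=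
  eLpNorm_mono fun x => PiLp.norm_apply_le (G x) i

theorem eLpNorm_euclidean_le_sum (hp : 1 ≤ p) {w : Fin d → EuclideanSpace ℝ (Fin d) → ℝ}
    (hw : ∀ i, AEStronglyMeasurable (w i) volume) :
    AEStronglyMeasurable (fun x => WithLp.toLp 2 fun i => w i x :
      EuclideanSpace ℝ (Fin d) → EuclideanSpace ℝ (Fin d)) volume ∧
    eLpNorm (fun x => WithLp.toLp 2 fun i => w i x :
      EuclideanSpace ℝ (Fin d) → EuclideanSpace ℝ (Fin d)) p volume
      ≤ ∑ i, eLpNorm (w i) p volume := by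
  have hsum : (fun x => WithLp.toLp 2 fun i => w i x :
      EuclideanSpace ℝ (Fin d) → EuclideanSpace ℝ (Fin d))
      = ∑ i, fun x => w i x • EuclideanSpace.single i (1 : ℝ) := by
    funext x
    ext j
    simp [Finset.sum_apply, Pi.single_apply]
  have hmeas : ∀ i, AEStronglyMeasurable
      (fun x => w i x • (EuclideanSpace.single i (1 : ℝ) : EuclideanSpace ℝ (Fin d))) volume :=
    fun i => (hw i).smul_const _
  rw [hsum]
  refine ⟨Finset.aestronglyMeasurable_sum _ fun i _ => hmeas i,
    (eLpNorm_sum_le (fun i _ => hmeas i) hp).trans (Finset.sum_le_sum fun i _ => ?_)⟩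
  refine (eLpNorm_mono fun x => ?_)
  simp [norm_smul]

/-- The componentwise derivatives are assembled into a vector field. The factor `d` comes from
bounding its norm by the sum of the component norms, each at most `C` times the norm of `G`. -/
theorem exists_hasWeakGradient_hlMaximalReal (hp : 1 < p) (hp_top : p < ⊤) {C : ℝ≥0}
    (hC : ∀ f : EuclideanSpace ℝ (Fin d) → ℝ, MemLp f p volume →
      MemLp (hlMaximalReal f) p volume ∧
        eLpNorm (hlMaximalReal f) p volume ≤ C * eLpNorm f p volume)
    {f : EuclideanSpace ℝ (Fin d) → ℝ} {G : EuclideanSpace ℝ (Fin d) → EuclideanSpace ℝ (Fin d)}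
    (hf : MemLp f p volume) (hG : HasWeakGradient f G) (hGp : MemLp G p volume) :
    ∃ W, HasWeakGradient (hlMaximalReal f) W ∧
      (∀ i, ∀ᵐ x, ‖W x i‖ₑ ≤ hlMaximal (fun y => G y i) x) ∧
      MemLp W p volume ∧ eLpNorm W p volume ≤ (d * C : ℝ≥0) * eLpNorm G p volume := by
  choose w hw hwle using fun i => exists_hasWeakPartialDeriv_hlMaximalReal hp hp_top hf
    (MemLp.euclidean_apply hGp i) (hG.partialDeriv i)
  obtain ⟨hmeas, hsum⟩ := eLpNorm_euclidean_le_sum hp.le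
    fun i => (hw i).locallyIntegrable_deriv.aestronglyMeasurable
  have hcomp : ∀ i, eLpNorm (w i) p volume ≤ C * eLpNorm G p volume := by
    intro i
    have hi := MemLp.euclidean_apply hGp i
    calc eLpNorm (w i) p volume
        ≤ eLpNorm (hlMaximalReal fun x => G x i) p volume := by
          refine eLpNorm_mono_enorm_ae ?_
          filter_upwards [hwle i, enorm_hlMaximalReal_ae_eq hp.le hp_top.ne hi] with x h1 h2
          rwa [h2]
      _ ≤ C * eLpNorm (fun x => G x i) p volume := (hC _ hi).2
      _ ≤ C * eLpNorm G p volume := by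
          gcongr
          exact eLpNorm_euclidean_apply_le G i
  have hle : eLpNorm (fun x => WithLp.toLp 2 fun i => w i x :
      EuclideanSpace ℝ (Fin d) → EuclideanSpace ℝ (Fin d)) p volume
      ≤ (d * C : ℝ≥0) * eLpNorm G p volume := by
    refine hsum.trans ((Finset.sum_le_sum fun i _ => hcomp i).trans_eq ?_)
    simp [mul_assoc]
  refine ⟨_, ⟨(hC f hf).1.locallyIntegrable hp.le, hw⟩, hwle, ⟨hmeas, ?_⟩, hle⟩
  exact hle.trans_lt (ENNReal.mul_lt_top ENNReal.coe_lt_top hGp.eLpNorm_lt_top)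

end SobolevBound

theorem theorem2p1 (d : ℕ) (p : ℝ≥0∞) (hp : 1 < p) (hp_top : p < ⊤) :
    (∀ f : EuclideanSpace ℝ (Fin d) → ℝ, MemW1p p f →
      (∀ᵐ x, hlMaximal f x < ⊤) ∧
      WeaklyDifferentiable (hlMaximalReal f) ∧
      ∀ (i : Fin d) (v w : EuclideanSpace ℝ (Fin d) → ℝ),
        HasWeakPartialDeriv i f v → HasWeakPartialDeriv i (hlMaximalReal f) w →
        ∀ᵐ x, ‖w x‖ₑ ≤ hlMaximal v x) ∧
    ∃ C : ℝ≥0, ∀ f : EuclideanSpace ℝ (Fin d) → ℝ, MemW1p p f →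
      MemW1p p (hlMaximalReal f) ∧ w1pNorm p (hlMaximalReal f) ≤ C * w1pNorm p f := by
  obtain ⟨C, hC⟩ := exists_eLpNorm_hlMaximalReal_le d hp hp_top
  refine ⟨?_, C + d * C, ?_⟩
  · rintro f ⟨hf, G, hG, hGp⟩
    obtain ⟨W, hW, hWle, -, -⟩ := exists_hasWeakGradient_hlMaximalReal hp hp_top hC hf hG hGp
    refine ⟨ae_hlMaximal_lt_top hp.le hp_top.ne hf, ⟨W, hW⟩, fun i v w hv hw => ?_⟩
    -- Uniqueness of weak derivatives transfers the bound from the constructed representatives to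
    -- arbitrary `v` and `w`.
    rw [hlMaximal_congr_ae (hv.ae_eq (hG.partialDeriv i))]
    filter_upwards [hWle i, hw.ae_eq (hW.partialDeriv i)] with x h1 h2
    rwa [h2]
  · rintro f ⟨hf, G, hG, hGp⟩
    obtain ⟨W, hW, -, hWp, hWle⟩ := exists_hasWeakGradient_hlMaximalReal hp hp_top hC hf hG hGp
    refine ⟨⟨(hC f hf).1, W, hW, hWp⟩, ?_⟩
    rw [w1pNorm_eq p hW, w1pNorm_eq p hG, mul_add]
    gcongr
    · refine (hC f hf).2.trans ?_
      gcongr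
      exact le_self_add
    · refine hWle.trans ?_
      gcongr
      exact le_add_self
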